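/- Let $\Phi$ be a (finite, nonempty) irreducible reduced crystallographic root system spanning the Euclidean space $\mathbb R^n$ with scalar product $\langle\cdot,\cdot\rangle$ (equivalently, the root system of a compact simply connected simple Lie group of rank $n$), with simple roots $\alpha_1,\dots,\alpha_n$ and coroots $\alpha^\vee=2\alpha/\langle\alpha,\alpha\rangle$. Let $W$ be its Weyl group, $c$ the determinant of its Cartan matrix, $\xi=m_1\alpha_1+\dots+m_n\alpha_n$ the highest root, and $\eta$ the highest root of the dual root system $\Phi^\vee=\{\alpha^\vee:\alpha\in\Phi\}$ with respect to the simple roots $\alpha_1^\vee,\dots,\alpha_n^\vee$. Let $\omega_i,\omega_i^\vee$ be given by $\langle\omega_i,\alpha_j^\vee\rangle=\delta_{ij}=\langle\omega_i^\vee,\alpha_j\rangle$, and put $P^+=\sum_i\mathbb Z_{\ge0}\,\omega_i$, $Q^\vee=\sum_i\mathbb Z\alpha_i^\vee$, $P^\vee=\sum_i\mathbb Z\omega_i^\vee$. Let $$F=\{y_1\omega_1^\vee+\dots+y_n\omega_n^\vee:\ y_0,\dots,y_n\ge0,\ y_0+m_1y_1+\dots+m_ny_n=1\},$$ with volume $|F|$,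 and $F_M=F\cap\frac1M P^\vee$ for $M\in\mathbb N=\{1,2,\dots\}$. For $x\in\mathbb R^n$ let $\varepsilon(x)$ be the number of elements of the $W$-orbit of the class of $x$ in $\mathbb R^n/Q^\vee$, and for $\lambda\in P^+$ let $$C_\lambda(x)=\sum_{\nu\in W\lambda}e^{2\pi i\langle\nu,x\rangle}.$$ Then for every integer $M\ge1$ and every $\lambda\in P^+$ whose $m$-degree $|\lambda|_m=\langle\lambda,\eta\rangle$ is at most $2M-1$, the set $F_M$ is finite, $C_\lambda$ is integrable on $F$, and $$\frac1{|F|}\int_F C_\lambda(x)\,dx=\frac1{c\,M^n}\sum_{x\in F_M}\varepsilon(x)\,C_\lambda(x).$$ -/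

import Mathlib

open MeasureTheory Module
open scoped RealInnerProductSpace

noncomputable section

namespace OrbitCubature

variable {n : ℕ} {ι : Type*}
  {P : RootPairing ι ℝ (EuclideanSpace ℝ (Fin n)) (EuclideanSpace ℝ (Fin n))}

/-- The root pairing lives in the Euclidean space `ℝⁿ`: roots and coroots are paired by the scalar
product, and `α^∨ = 2α / ⟨α, α⟩` for every root `α`. -/
structure IsEuclidean
    (P : RootPairing ι ℝ (EuclideanSpace ℝ (Fin n)) (EuclideanSpace ℝ (Fin n))) : Prop where
  toLinearMap_apply : ∀ x y, P.toLinearMap x y = ⟪x, y⟫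
  coroot_eq : ∀ i, P.coroot i = (2 / ⟪P.root i, P.root i⟫) • P.root i

/-- The index of the highest root, that is, of the root of greatest height with respect to the
simple roots (for an irreducible reduced crystallographic root system it is unique). Applied to the
dual base `b.flip` this gives the index of the highest dual root. -/
def highestIdx [Finite ι] [Nonempty ι] (b : P.Base) : ι :=
  (Finite.exists_max b.height).choose

lemma height_le_height_highestIdx [Finite ι] [Nonempty ι] (b : P.Base) (i : ι) :
    b.height i ≤ b.height (highestIdx b) :=
  (Finite.exists_max b.height).choose_spec i

/-- The mark `mᵢ`: the coefficient of the simple root `αᵢ` in the highest root `ξ = ∑ mᵢ αᵢ`. -/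
def mark [Finite ι] [Nonempty ι] [P.IsRootSystem] (b : P.Base) (i : b.support) : ℝ :=
  b.toWeightBasis.repr (P.root (highestIdx b)) i

/-- The highest dual root `η`: the highest root of the dual root system. -/
def highestDualRoot [Finite ι] [Nonempty ι] (b : P.Base) : EuclideanSpace ℝ (Fin n) :=
  P.coroot (highestIdx b.flip)

/-- The determinant `c` of the Cartan matrix. -/
def cartanDet [P.IsCrystallographic] (b : P.Base) : ℤ :=
  open scoped Classical in b.cartanMatrix.det

/-- The vectors `ω_i^∨`, dual to the simple roots. -/
def omegaCheck [P.IsRootSystem] (b : P.Base) (i : b.support) : EuclideanSpace ℝ (Fin n) :=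
  P.toLinearMap.flip.toPerfPair.symm (b.toWeightBasis.coord i)

/-- The vectors `ω_i`, dual to the simple coroots. -/
def omega [P.IsRootSystem] (b : P.Base) (i : b.support) : EuclideanSpace ℝ (Fin n) :=
  P.toLinearMap.toPerfPair.symm (b.toCoweightBasis.coord i)

lemma inner_root_omegaCheck [P.IsRootSystem] (hP : IsEuclidean P) (b : P.Base)
    (i j : b.support) :
    ⟪omegaCheck b i, P.root j⟫ = open scoped Classical in if i = j then 1 else 0 := by
  classical
  rw [real_inner_comm, ← hP.toLinearMap_apply, omegaCheck, LinearMap.apply_toPerfPair_flip,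
    Basis.coord_apply, RootPairing.Base.toWeightBasis_repr_root, Finsupp.single_apply]
  simp only [eq_comm]

lemma inner_omega_coroot [P.IsRootSystem] (hP : IsEuclidean P) (b : P.Base)
    (i j : b.support) :
    ⟪omega b i, P.coroot j⟫ = open scoped Classical in if i = j then 1 else 0 := by
  classical
  rw [← hP.toLinearMap_apply, omega, LinearMap.apply_symm_toPerfPair_self,
    Basis.coord_apply, RootPairing.Base.toCoweightBasis_repr_coroot, Finsupp.single_apply]
  simp only [eq_comm]

/-- The cone of positive weights `P⁺ = ℤ≥0 ω₁ + ⋯ + ℤ≥0 ωₙ`. -/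
def positiveWeights [P.IsRootSystem] (b : P.Base) : Set (EuclideanSpace ℝ (Fin n)) :=
  {lam | ∃ k : b.support → ℕ, lam = ∑ i, (k i : ℝ) • omega b i}

/-- The `m`-degree `|λ|_m = ⟨λ, η⟩`. -/
def mDegree [Finite ι] [Nonempty ι] (b : P.Base) (lam : EuclideanSpace ℝ (Fin n)) : ℝ :=
  ⟪lam, highestDualRoot b⟫

/-- `P⁺_K`: the positive weights of `m`-degree at most `K`. -/
def positiveWeightsLE [Finite ι] [Nonempty ι] [P.IsRootSystem] (b : P.Base) (K : ℕ) :
    Set (EuclideanSpace ℝ (Fin n)) :=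
  {lam ∈ positiveWeights b | mDegree b lam ≤ K}

/-- The dual root lattice `Q^∨ = ℤ α₁^∨ + ⋯ + ℤ αₙ^∨`. -/
def dualRootLattice (b : P.Base) : AddSubgroup (EuclideanSpace ℝ (Fin n)) :=
  AddSubgroup.closure (P.coroot '' b.support)

/-- The lattice `P^∨ = ℤ ω₁^∨ + ⋯ + ℤ ωₙ^∨`, the `ℤ`-dual of the root lattice. -/
def dualWeightLattice (b : P.Base) : AddSubgroup (EuclideanSpace ℝ (Fin n)) where
  carrier := {x | ∀ i ∈ b.support, ∃ k : ℤ, ⟪x, P.root i⟫ = k}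
  zero_mem' := fun _ _ => ⟨0, by simp⟩
  add_mem' := by
    intro x y hx hy i hi
    obtain ⟨k, hk⟩ := hx i hi
    obtain ⟨l, hl⟩ := hy i hi
    exact ⟨k + l, by rw [inner_add_left, hk, hl]; push_cast; rfl⟩
  neg_mem' := by
    intro x hx i hi
    obtain ⟨k, hk⟩ := hx i hi
    exact ⟨-k, by rw [inner_neg_left, hk]; push_cast; rfl⟩

/-- The fundamental domain `F` of the affine Weyl group: the simplex of the points
`∑ yᵢ ωᵢ^∨` with `y₀, …, yₙ ≥ 0` and `y₀ + ∑ mᵢ yᵢ = 1`. -/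
def fundamentalDomain [Finite ι] [Nonempty ι] [P.IsRootSystem] (b : P.Base) :
    Set (EuclideanSpace ℝ (Fin n)) :=
  {x | ∃ (y₀ : ℝ) (y : b.support → ℝ), 0 ≤ y₀ ∧ (∀ i, 0 ≤ y i) ∧
    y₀ + ∑ i, y i * mark b i = 1 ∧ x = ∑ i, y i • omegaCheck b i}

/-- The grid `F_M`: the points of `F` that lie in `(1/M) P^∨`. They represent the cosets in
`(1/M) P^∨ / Q^∨` that meet `F`, each coset once. -/
def grid [Finite ι] [Nonempty ι] [P.IsRootSystem] (b : P.Base) (M : ℕ) :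
    Set (EuclideanSpace ℝ (Fin n)) :=
  {x ∈ fundamentalDomain b | (M : ℝ) • x ∈ dualWeightLattice b}

/-- `ε(x)`: the number of elements of the Weyl group orbit of the class of `x` in the torus
`ℝⁿ / Q^∨`. -/
def orbitCard (b : P.Base) (x : EuclideanSpace ℝ (Fin n)) : ℕ :=
  Set.ncard (Set.range fun w : P.weylGroup =>
    (QuotientAddGroup.mk (w • x) : EuclideanSpace ℝ (Fin n) ⧸ dualRootLattice b))

lemma finite_orbit [Finite ι] [P.IsRootSystem] (lam : EuclideanSpace ℝ (Fin n)) :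
    (MulAction.orbit P.weylGroup lam).Finite := by
  classical
  have := Fintype.ofFinite ι
  have hl : lam ∈ Submodule.span ℝ (Set.range P.root) := by simp
  obtain ⟨a, rfl⟩ := (Submodule.mem_span_range_iff_exists_fun ℝ).1 hl
  refine (Set.finite_range fun σ : Equiv.Perm ι => ∑ i, a i • P.root (σ i)).subset ?_
  rintro _ ⟨w, rfl⟩
  refine ⟨P.weylGroupToPerm w, ?_⟩
  simp only [Finset.smul_sum, smul_comm w, RootPairing.weylGroup_apply_root]

/-- The symmetric orbit function `C_λ(x) = ∑_{ν ∈ Wλ} e^{2πi⟨ν, x⟩}`. -/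
def orbitFunction [Finite ι] [P.IsRootSystem] (lam x : EuclideanSpace ℝ (Fin n)) : ℂ :=
  ∑ ν ∈ (finite_orbit (P := P) lam).toFinset,
    Complex.exp (2 * Real.pi * Complex.I * (⟪ν, x⟫ : ℝ))

end OrbitCubature

end

/-! Both sides average `C_λ`: on the left over the torus `ℝⁿ/Q^∨`, on the right over its finite
subgroup `(1/M)P^∨/Q^∨`. For `λ = 0` each average is `1`. For `λ ≠ 0` each vanishes by orthogonality
of characters, and the degree bound is what keeps the characters nontrivial on the finite subgroup.

The passage from `F` to the torus rests on the affine Weyl group `W ⋉ Q^∨`: every point is conjugate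
to a point of `F` (`exists_smul_add_mem_fundamentalDomain`), to only one
(`eq_of_mem_fundamentalDomain`), and the action on alcoves is free (`eq_one_of_alcove`). Hence the
`W`-images of the open alcove form a fundamental domain of `Q^∨`, and `ε` counts the torus points
above each grid point (`sum_grid_eq_sum_torusPoints`). The subgroup has `c Mⁿ` elements because the
simple coroots, written in the basis `ω_i^∨/M`, have matrix `M` times the Cartan matrix
(`relIndex_gridLattice`).

If `λ` were trivial on `(1/M)P^∨`, then `λ = Mμ` with `μ` in the root lattice. A nonzero such `μ`
pairs to at least `2` with some coroot (`exists_two_le_pairing`), and the highest dual root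
maximizes the pairing with a dominant vector (`inner_coroot_le_mDegree`), so `|λ|_m ≥ 2M`. The dual
form of the same fact about the number `2` also gives the freeness on alcoves. -/

noncomputable section

namespace OrbitCubature

variable {n : ℕ} {ι : Type*} [Finite ι]
  {P : RootPairing ι ℝ (EuclideanSpace ℝ (Fin n)) (EuclideanSpace ℝ (Fin n))}

/-! ### Coefficients of roots in the simple roots -/

section Coefficients

variable [P.IsRootSystem]

omit [Finite ι] in
lemma exists_int_coeff (b : P.Base) (i : ι) :
    ∃ f : b.support → ℤ, (∀ j, b.toWeightBasis.repr (P.root i) j = f j) ∧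
      b.height i = ∑ j, f j ∧ ((∀ j, 0 ≤ f j) ∨ ∀ j, f j ≤ 0) := by
  classical
  obtain ⟨f, -, hf, h⟩ := b.exists_root_eq_sum_int i
  refine ⟨fun j => f j, fun j => ?_, ?_, ?_⟩
  · have h' : P.root i = ∑ k : b.support, (f k : ℝ) • b.toWeightBasis k := by
      rw [h, ← Finset.sum_coe_sort]
      simp [Int.cast_smul_eq_zsmul]
    rw [h', Basis.repr_sum_self]
  · rw [b.height_eq_sum h, ← Finset.sum_coe_sort]
  · exact hf.imp (fun h j => h.le _) (fun h j => h.le _)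

omit [Finite ι] in
lemma repr_nonneg_of_isPos (b : P.Base) {i : ι} (hi : b.IsPos i) (j : b.support) :
    0 ≤ b.toWeightBasis.repr (P.root i) j := by
  obtain ⟨f, h, h', hf | hf⟩ := exists_int_coeff b i
  · rw [h]; exact_mod_cast hf j
  · rw [b.isPos_iff, h'] at hi
    exact absurd hi (not_lt.2 (Finset.sum_nonpos fun j _ => hf j))

omit [Finite ι] in
lemma sum_repr_smul_root (b : P.Base) (x : EuclideanSpace ℝ (Fin n)) :
    ∑ j, b.toWeightBasis.repr x j • P.root j = x := by
  simpa using b.toWeightBasis.sum_repr x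

end Coefficients

/-! ### The highest root dominates all roots -/

section HighestRoot

variable [Nonempty ι] [P.IsCrystallographic]

omit [P.IsCrystallographic] in
lemma isPos_highestIdx (b : P.Base) : b.IsPos (highestIdx b) := by
  let _ := P.indexNeg
  obtain h | h := RootPairing.Base.IsPos.or_neg b (highestIdx b)
  · exact h
  · exact lt_of_lt_of_le h (height_le_height_highestIdx b _)

omit [Finite ι] [Nonempty ι] in
lemma height_reflectionPerm (b : P.Base) {i j : ι} (hj : j ∈ b.support) :
    b.height (P.reflectionPerm j i) = b.height i - P.pairingIn ℤ i j := by
  have : P.root (P.reflectionPerm j i) = P.root i + (-P.pairingIn ℤ i j) • P.root j := by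
    rw [P.root_reflectionPerm, neg_smul, P.reflection_apply_root' ℤ, sub_eq_add_neg]
  rw [b.height_add_zsmul this, b.height_one_of_mem_support hj]
  simp [sub_eq_add_neg]

lemma pairingIn_highestIdx_nonneg (b : P.Base) {j : ι} (hj : j ∈ b.support) :
    0 ≤ P.pairingIn ℤ (highestIdx b) j := by
  have h := height_le_height_highestIdx b (P.reflectionPerm j (highestIdx b))
  rw [height_reflectionPerm b hj] at h
  linarith

variable [P.IsRootSystem]

omit [Finite ι] [Nonempty ι] [P.IsCrystallographic] in
lemma pairing_eq_sum_repr (b : P.Base) (i k : ι) :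
    P.pairing i k = ∑ j, b.toWeightBasis.repr (P.root i) j * P.pairing j k := by
  conv_lhs => rw [← P.root_coroot_eq_pairing, ← sum_repr_smul_root b (P.root i)]
  simp

variable [P.IsReduced] [P.IsIrreducible]

/-- By maximality of the height, the highest root pairs nonnegatively with every simple coroot. If
its coefficient at `k` vanished while a neighbour `i` of `k` had a nonzero one, its pairing with the
coroot of `k` would be negative. Irreducibility connects the Dynkin diagram, so nonvanishing spreads
to all nodes. -/
lemma repr_highestIdx_pos (b : P.Base) (j : b.support) :
    0 < b.toWeightBasis.repr (P.root (highestIdx b)) j := by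
  classical
  have hnn := repr_nonneg_of_isPos b (isPos_highestIdx b)
  suffices b.toWeightBasis.repr (P.root (highestIdx b)) j ≠ 0 from (hnn j).lt_of_ne' this
  obtain ⟨i, hi⟩ : ∃ i, b.toWeightBasis.repr (P.root (highestIdx b)) i ≠ 0 := by
    by_contra! h
    apply P.ne_zero (highestIdx b)
    rw [← sum_repr_smul_root b (P.root (highestIdx b))]
    simp [h]
  refine b.induction_on_cartanMatrix
    (fun j => b.toWeightBasis.repr (P.root (highestIdx b)) j ≠ 0) hi fun i k hi hik hk => ?_
  have hne : i ≠ k := by rintro rfl; exact hi hk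
  have hneg : P.pairing i k < 0 := by
    rw [← P.algebraMap_pairingIn ℤ, algebraMap_int_eq, eq_intCast]
    refine Int.cast_lt_zero.2 (lt_of_le_of_ne (b.cartanMatrix_le_zero_of_ne i k hne) ?_)
    rwa [ne_eq, b.cartanMatrix_apply_eq_zero_iff_symm] at hik
  have h0 : 0 ≤ P.pairing (highestIdx b) k := by
    rw [← P.algebraMap_pairingIn ℤ, algebraMap_int_eq, eq_intCast]
    exact_mod_cast pairingIn_highestIdx_nonneg b k.2
  rw [pairing_eq_sum_repr b] at h0
  refine absurd h0 (not_le.2 ?_)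
  refine Finset.sum_neg' (fun l _ => ?_) ⟨i, Finset.mem_univ _, ?_⟩
  · rcases eq_or_ne l k with rfl | hl
    · simp [hk]
    · refine mul_nonpos_of_nonneg_of_nonpos (hnn l) ?_
      rw [← P.algebraMap_pairingIn ℤ, algebraMap_int_eq, eq_intCast]
      exact_mod_cast b.cartanMatrix_le_zero_of_ne l k hl
  · exact mul_neg_of_pos_of_neg ((hnn i).lt_of_ne' hi) hneg

/-- The highest root dominates every root coefficientwise. -/
lemma repr_le_repr_highestIdx (b : P.Base) (k : ι) (j : b.support) :
    b.toWeightBasis.repr (P.root k) j ≤ b.toWeightBasis.repr (P.root (highestIdx b)) j := by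
  classical
  -- A root of maximal height among those dominating `k` is dominant: reflecting it in a simple root
  -- of negative pairing would raise its height and stay in `S`.
  let S : Set ι := {l | ∀ j, b.toWeightBasis.repr (P.root k) j ≤ b.toWeightBasis.repr (P.root l) j}
  obtain ⟨l, hlS, hl⟩ := Set.exists_max_image S b.height S.toFinite ⟨k, fun _ => le_rfl⟩
  have hdom : ∀ i : b.support, 0 ≤ P.pairingIn ℤ l i := by
    intro i
    by_contra! hneg
    have hmem : P.reflectionPerm i l ∈ S := by
      intro j
      refine (hlS j).trans ?_
      rw [P.root_reflectionPerm, P.reflection_apply_root' ℤ, map_sub, map_zsmul,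
        Finsupp.sub_apply, Finsupp.smul_apply, b.toWeightBasis_repr_root, zsmul_eq_mul]
      have : (P.pairingIn ℤ l i : ℝ) * Finsupp.single i (1 : ℝ) j ≤ 0 := by
        refine mul_nonpos_of_nonpos_of_nonneg (by exact_mod_cast hneg.le) ?_
        rw [Finsupp.single_apply]; split_ifs <;> norm_num
      linarith
    have := hl _ hmem
    rw [height_reflectionPerm b i.2] at this
    linarith
  -- All coefficients of the highest root are positive and `l` is dominant with some nonzero
  -- pairing. Consequently the highest root minus `l` is zero or a root, and a root of nonnegative
  -- height is positive.
  have hpos : 0 < P.pairingIn ℤ (highestIdx b) l := by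
    obtain ⟨i, hi⟩ : ∃ i : b.support, P.pairingIn ℤ l i ≠ 0 := by
      obtain ⟨i, hi, h⟩ := b.exists_mem_support_pos_pairingIn_ne_zero l
      exact ⟨⟨i, hi⟩, P.pairingIn_eq_zero_iff.not.1 h⟩
    have hi' := (hdom i).lt_of_ne' hi
    have : (0 : ℝ) < P.pairing (highestIdx b) l := by
      rw [pairing_eq_sum_repr b]
      refine Finset.sum_pos' (fun j _ => ?_) ⟨i, Finset.mem_univ _, ?_⟩
      · refine mul_nonneg (repr_highestIdx_pos b j).le ?_
        rw [← P.algebraMap_pairingIn ℤ, algebraMap_int_eq, eq_intCast]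
        have := P.pairingIn_lt_zero_iff ℤ (i := l) (j := j)
        exact_mod_cast not_lt.1 (this.not.1 (hdom j).not_gt)
      · refine mul_pos (repr_highestIdx_pos b i) ?_
        rw [← P.algebraMap_pairingIn ℤ, algebraMap_int_eq, eq_intCast]
        have := P.zero_lt_pairingIn_iff' (S := ℤ) (i := l) (j := i)
        exact_mod_cast this.1 hi'
    rw [← P.algebraMap_pairingIn ℤ, algebraMap_int_eq, eq_intCast] at this
    exact_mod_cast this
  refine (hlS j).trans ?_
  rcases eq_or_ne (highestIdx b) l with h | h
  · rw [h]
  obtain ⟨m, hm⟩ := P.root_sub_root_mem_of_pairingIn_pos hpos h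
  have hmpos : b.IsPos m := by
    rw [b.isPos_iff', b.height_sub hm]
    linarith [height_le_height_highestIdx b l]
  have := repr_nonneg_of_isPos b hmpos j
  rw [hm, map_sub, Finsupp.sub_apply] at this
  linarith

end HighestRoot

/-! ### Pairings of root lattice vectors with coroots -/

section Minuscule

variable [P.IsCrystallographic]

/-- A nonzero element of the root lattice pairs to at least `2` with some coroot. -/
lemma exists_two_le_pairing {x : EuclideanSpace ℝ (Fin n)}
    (hx : x ∈ AddSubgroup.closure (Set.range P.root)) (hx0 : x ≠ 0) :
    ∃ i, 2 ≤ P.toLinearMap x (P.coroot i) := by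
  classical
  -- Negatives of roots are roots, so `x` is a sum of roots; a shortest such sum is taken, and the
  -- coroot of any of its terms will do.
  have hex : ∃ k : ℕ, ∃ s : Multiset ι, s.card = k ∧ (s.map P.root).sum = x := by
    suffices ∃ s : Multiset ι, (s.map P.root).sum = x from
      this.elim fun s hs => ⟨_, s, rfl, hs⟩
    let _ := P.indexNeg
    induction hx using AddSubgroup.closure_induction with
    | mem x hx => obtain ⟨i, rfl⟩ := hx; exact ⟨{i}, by simp⟩
    | zero => exact ⟨0, by simp⟩
    | add x y _ _ hx hy =>
      by_cases hx' : x = 0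
      · by_cases hy' : y = 0
        · exact ⟨0, by simp [hx', hy']⟩
        · obtain ⟨s, hs⟩ := hy hy'; exact ⟨s, by simp [hs, hx']⟩
      · by_cases hy' : y = 0
        · obtain ⟨s, hs⟩ := hx hx'; exact ⟨s, by simp [hs, hy']⟩
        · obtain ⟨s, hs⟩ := hx hx'
          obtain ⟨t, ht⟩ := hy hy'
          exact ⟨s + t, by simp [hs, ht]⟩
    | neg x _ hx =>
      obtain ⟨s, hs⟩ := hx (by simpa using hx0)
      refine ⟨s.map (fun i => -i), ?_⟩
      rw [← hs, ← Multiset.sum_map_neg']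
      simp
  obtain ⟨s, hs, hsx⟩ := Nat.find_spec hex
  have hmin : ∀ t : Multiset ι, (t.map P.root).sum = x → s.card ≤ t.card := fun t ht => by
    rw [hs]; exact Nat.find_min' hex ⟨t, rfl, ht⟩
  obtain rfl | ⟨a, ha⟩ := s.empty_or_exists_mem
  · simp at hsx; exact absurd hsx.symm hx0
  obtain ⟨t, rfl⟩ := Multiset.exists_cons_of_mem ha
  refine ⟨a, ?_⟩
  -- Two terms with negative pairing could be cancelled or replaced by the single root that is their
  -- sum, shortening the expression. The term `a` itself contributes the `2`.
  have hb : ∀ c ∈ t, 0 ≤ P.pairing c a := by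
    intro c hc
    obtain ⟨u, rfl⟩ := Multiset.exists_cons_of_mem hc
    rw [← P.algebraMap_pairingIn ℤ, algebraMap_int_eq, eq_intCast]
    by_contra! hneg
    replace hneg : P.pairingIn ℤ c a < 0 := by exact_mod_cast hneg
    by_cases hca : P.root c = -P.root a
    · have := hmin u (by rw [← hsx]; simp [hca])
      simp at this
    · obtain ⟨m, hm⟩ := P.root_add_root_mem_of_pairingIn_neg hneg hca
      have := hmin (m ::ₘ u) (by rw [← hsx]; simp [hm]; abel)
      simp at this
  rw [← hsx]
  have h0 : 0 ≤ (t.map fun c => P.pairing c a).sum := by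
    refine Multiset.sum_nonneg fun y hy => ?_
    obtain ⟨c, hc, rfl⟩ := Multiset.mem_map.1 hy
    exact hb c hc
  have h1 : P.toLinearMap (t.map P.root).sum (P.coroot a) = (t.map fun c => P.pairing c a).sum := by
    have := map_multiset_sum (P.toLinearMap.flip (P.coroot a)) (t.map P.root)
    simpa [Multiset.map_map, Function.comp_def] using this
  simp only [Multiset.map_cons, Multiset.sum_cons, map_add, LinearMap.add_apply, h1,
    P.root_coroot_two]
  linarith

end Minuscule

/-! ### The Weyl group as a finite group of isometries -/

section Weyl

variable {n : ℕ} {ι : Type*}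
  {P : RootPairing ι ℝ (EuclideanSpace ℝ (Fin n)) (EuclideanSpace ℝ (Fin n))}

/-- The normalization `α^∨ = 2α/⟨α, α⟩` is an involution, so results on roots transfer to coroots.
-/
lemma IsEuclidean.flip (hP : IsEuclidean P) : IsEuclidean P.flip where
  toLinearMap_apply x y := by
    rw [real_inner_comm, ← hP.toLinearMap_apply]; rfl
  coroot_eq i := by
    have h0 : ⟪P.root i, P.root i⟫ ≠ 0 := inner_self_ne_zero.2 (P.ne_zero i)
    change P.root i = (2 / ⟪P.coroot i, P.coroot i⟫) • P.coroot i
    rw [hP.coroot_eq i, inner_smul_left, inner_smul_right, smul_smul]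
    conv_lhs => rw [← one_smul ℝ (P.root i)]
    congr 1
    simp only [conj_trivial]
    field_simp

lemma IsEuclidean.inner_root_coroot (hP : IsEuclidean P) (i j : ι) :
    ⟪P.root i, P.coroot j⟫ = P.pairing i j := by
  rw [← hP.toLinearMap_apply]; rfl

lemma IsEuclidean.reflection_apply (hP : IsEuclidean P) (i : ι) (x : EuclideanSpace ℝ (Fin n)) :
    P.reflection i x = x - ⟪x, P.coroot i⟫ • P.root i := by
  rw [← hP.toLinearMap_apply, P.reflection_apply]; rfl

lemma IsEuclidean.reflection_apply' (hP : IsEuclidean P) (i : ι) (x : EuclideanSpace ℝ (Fin n)) :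
    P.reflection i x = x - ⟪x, P.root i⟫ • P.coroot i := by
  rw [hP.reflection_apply, hP.coroot_eq, inner_smul_right, smul_smul, mul_comm]

lemma IsEuclidean.inner_smul_smul (hP : IsEuclidean P) (w : P.weylGroup)
    (x y : EuclideanSpace ℝ (Fin n)) : ⟪w • x, w • y⟫ = ⟪x, y⟫ := by
  obtain ⟨w, hw⟩ := w
  induction hw using RootPairing.weylGroup.induction generalizing x y with
  | mem i =>
    have h0 : ⟪P.root i, P.root i⟫ ≠ 0 := inner_self_ne_zero.2 (P.ne_zero i)
    change ⟪P.reflection i x, P.reflection i y⟫ = _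
    rw [hP.reflection_apply, hP.reflection_apply, hP.coroot_eq]
    simp only [inner_sub_left, inner_sub_right, inner_smul_left, inner_smul_right, conj_trivial]
    rw [real_inner_comm y (P.root i)]
    field_simp
    ring
  | one => rfl
  | mul g h _ _ hg hh => exact (hg (h • x) (h • y)).trans (hh x y)

lemma IsEuclidean.norm_smul (hP : IsEuclidean P) (w : P.weylGroup)
    (x : EuclideanSpace ℝ (Fin n)) : ‖w • x‖ = ‖x‖ := by
  rw [norm_eq_sqrt_real_inner, hP.inner_smul_smul, ← norm_eq_sqrt_real_inner]

lemma IsEuclidean.inner_smul_left_eq (hP : IsEuclidean P) (w : P.weylGroup)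
    (x y : EuclideanSpace ℝ (Fin n)) : ⟪w • x, y⟫ = ⟪x, w⁻¹ • y⟫ := by
  rw [← hP.inner_smul_smul w⁻¹, inv_smul_smul]

lemma IsEuclidean.smul_coroot (hP : IsEuclidean P) (w : P.weylGroup) (i : ι) :
    w • P.coroot i = P.coroot (P.weylGroupToPerm w i) := by
  rw [hP.coroot_eq, hP.coroot_eq, ← RootPairing.weylGroup_apply_root, hP.inner_smul_smul,
    smul_comm]

lemma ofIdx_smul_eq (hP : IsEuclidean P) (i : ι) (x : EuclideanSpace ℝ (Fin n)) :
    RootPairing.weylGroup.ofIdx P i • x = x - ⟪x, P.root i⟫ • P.coroot i :=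
  hP.reflection_apply' i x

lemma toPerm_ofIdx (i : ι) :
    P.weylGroupToPerm (RootPairing.weylGroup.ofIdx P i) = P.reflectionPerm i := rfl

lemma weyl_ext [P.IsRootSystem] {g h : P.weylGroup}
    (H : ∀ x : EuclideanSpace ℝ (Fin n), g • x = h • x) : g = h := by
  refine Subtype.ext (RootPairing.Equiv.weightHom_injective P ?_)
  ext x : 1
  exact H x

instance finite_weylGroup [Finite ι] [P.IsRootSystem] : Finite P.weylGroup := by
  refine Finite.of_injective P.weylGroupToPerm fun g h hgh => weyl_ext fun x => ?_
  have hx : x ∈ Submodule.span ℝ (Set.range P.root) := by simp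
  induction hx using Submodule.span_induction with
  | mem x hx =>
    obtain ⟨i, rfl⟩ := hx
    rw [RootPairing.weylGroup_apply_root, RootPairing.weylGroup_apply_root, hgh]
  | zero => rw [smul_zero, smul_zero]
  | add x y _ _ hx hy => rw [smul_add, smul_add, hx, hy]
  | smul a x _ hx => rw [smul_comm, smul_comm h, hx]

/-- The orthogonal transformation by which an element of the Weyl group acts. -/
def weylIsometry (hP : IsEuclidean P) (w : P.weylGroup) :
    EuclideanSpace ℝ (Fin n) ≃ₗᵢ[ℝ] EuclideanSpace ℝ (Fin n) where
  toLinearEquiv := RootPairing.Equiv.weightHom P w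
  norm_map' := hP.norm_smul w

end Weyl

/-! ### Simple reflections and the exchange property -/

section SimpleTransitivity

variable {n : ℕ} {ι : Type*}
  {P : RootPairing ι ℝ (EuclideanSpace ℝ (Fin n)) (EuclideanSpace ℝ (Fin n))}

lemma reflection_conj (hP : IsEuclidean P) (w : P.weylGroup) (i : ι)
    (x : EuclideanSpace ℝ (Fin n)) :
    w • RootPairing.weylGroup.ofIdx P i • x =
      RootPairing.weylGroup.ofIdx P (P.weylGroupToPerm w i) • w • x := by
  rw [ofIdx_smul_eq hP, ofIdx_smul_eq hP, smul_sub, smul_comm w, hP.smul_coroot,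
    ← RootPairing.weylGroup_apply_root, hP.inner_smul_smul]

lemma ofIdx_conj [P.IsRootSystem] (hP : IsEuclidean P) (w : P.weylGroup) (i : ι) :
    w * RootPairing.weylGroup.ofIdx P i =
      RootPairing.weylGroup.ofIdx P (P.weylGroupToPerm w i) * w :=
  weyl_ext fun x => by rw [mul_smul, mul_smul, reflection_conj hP]

lemma ofIdx_mul_self [P.IsRootSystem] (i : ι) :
    RootPairing.weylGroup.ofIdx P i * RootPairing.weylGroup.ofIdx P i = 1 := by
  refine weyl_ext fun x => ?_
  rw [mul_smul, one_smul]
  change P.reflection i (P.reflection i x) = x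
  simp

/-- The product of the simple reflections in a list. -/
def wordProd (b : P.Base) (l : List b.support) : P.weylGroup :=
  (l.map fun i : b.support => RootPairing.weylGroup.ofIdx P i).prod

variable [Finite ι] [P.IsRootSystem] [P.IsCrystallographic] [P.IsReduced]

/-- Every root is reached from simple roots by simple reflections, and conjugating a reflection by
`g` gives the reflection in the image root; so the subgroup generated by simple reflections contains
all reflections. -/
lemma exists_wordProd_eq (hP : IsEuclidean P) (b : P.Base) (w : P.weylGroup) :
    ∃ l, w = wordProd b l := by
  let H : Subgroup P.weylGroup :=
    Subgroup.closure (Set.range fun i : b.support => RootPairing.weylGroup.ofIdx P i)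
  have hmem : ∀ i, RootPairing.weylGroup.ofIdx P i ∈ H := by
    have key : ∀ i j, RootPairing.weylGroup.ofIdx P i ∈ H → RootPairing.weylGroup.ofIdx P j ∈ H →
        RootPairing.weylGroup.ofIdx P (P.reflectionPerm j i) ∈ H := by
      intro i j hi hj
      have := ofIdx_conj hP (RootPairing.weylGroup.ofIdx P j) i
      rw [toPerm_ofIdx] at this
      rw [eq_mul_inv_iff_mul_eq.2 this.symm]
      exact H.mul_mem (H.mul_mem hj hi) (H.inv_mem hj)
    intro i
    refine b.induction_reflect i (p := fun i => RootPairing.weylGroup.ofIdx P i ∈ H)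
      (fun i hi => key i i hi hi)
      (fun i hi => Subgroup.subset_closure ⟨⟨i, hi⟩, rfl⟩)
      (fun i j hi hj => key i j hi (Subgroup.subset_closure ⟨⟨j, hj⟩, rfl⟩))
  have hw : w ∈ H := by
    obtain ⟨w, hw⟩ := w
    induction hw using RootPairing.weylGroup.induction with
    | mem i => exact hmem i
    | one => exact H.one_mem
    | mul g h _ _ hg hh => exact H.mul_mem hg hh
  induction hw using Subgroup.closure_induction with
  | mem x hx => obtain ⟨i, rfl⟩ := hx; exact ⟨[i], by simp [wordProd]⟩
  | one => exact ⟨[], rfl⟩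
  | mul x y _ _ hx hy =>
    obtain ⟨l, rfl⟩ := hx
    obtain ⟨m, rfl⟩ := hy
    exact ⟨l ++ m, by simp [wordProd]⟩
  | inv x _ hx =>
    obtain ⟨l, rfl⟩ := hx
    refine ⟨l.reverse, ?_⟩
    rw [wordProd, List.prod_inv_reverse, wordProd, List.map_reverse, List.map_map]
    congr 2
    refine List.map_congr_left fun i _ => ?_
    exact inv_eq_of_mul_eq_one_right (ofIdx_mul_self _)

/-- Apply the letters to `α_j` from the right. At the letter `i` where the root turns negative it
must equal `α_i`, since a simple reflection permutes the other positive roots. Conjugation then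
cancels that letter against the reflection in `α_j`. -/
lemma exchange (hP : IsEuclidean P) (b : P.Base) (j : b.support) (l : List b.support)
    (hl : ¬ b.IsPos (P.weylGroupToPerm (wordProd b l) j)) :
    ∃ m : List b.support, m.length + 1 = l.length ∧
      wordProd b l * RootPairing.weylGroup.ofIdx P j = wordProd b m := by
  induction l with
  | nil => exact absurd (b.isPos_of_mem_support j.2) hl
  | cons i t ih =>
    have hcons : wordProd b (i :: t) = RootPairing.weylGroup.ofIdx P i * wordProd b t := by
      simp [wordProd]
    by_cases ht : b.IsPos (P.weylGroupToPerm (wordProd b t) j)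
    · have heq : P.weylGroupToPerm (wordProd b t) j = i := by
        by_contra hne
        apply hl
        rw [hcons, map_mul, Equiv.Perm.mul_apply, toPerm_ofIdx]
        exact ht.reflectionPerm i.2 hne
      refine ⟨t, rfl, ?_⟩
      rw [hcons, mul_assoc, ofIdx_conj hP, heq, ← mul_assoc, ofIdx_mul_self, one_mul]
    · obtain ⟨m, hm, h⟩ := ih ht
      refine ⟨i :: m, by simpa using hm, ?_⟩
      rw [hcons, mul_assoc, h]
      simp [wordProd]

omit [Finite ι] [P.IsRootSystem] [P.IsCrystallographic] [P.IsReduced] in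
lemma isPos_reflectionPerm_self (b : P.Base) (i : ι) :
    b.IsPos (P.reflectionPerm i i) ↔ ¬ b.IsPos i :=
  RootPairing.Base.IsPos.neg_iff_not b i

/-- An element of the Weyl group that preserves the positive roots is trivial. -/
lemma eq_one_of_forall_isPos (hP : IsEuclidean P) (b : P.Base) (w : P.weylGroup)
    (hw : ∀ i, b.IsPos i → b.IsPos (P.weylGroupToPerm w i)) : w = 1 := by
  obtain ⟨l, rfl⟩ := exists_wordProd_eq hP b w
  induction h : l.length using Nat.strong_induction_on generalizing l with
  | _ k ih =>
    obtain rfl | ⟨t, j, rfl⟩ := l.eq_nil_or_concat'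
    · rfl
    have hcat : wordProd b (t ++ [j]) = wordProd b t * RootPairing.weylGroup.ofIdx P j := by
      simp [wordProd]
    -- The last letter negates `α_j`, so the remaining word must send `α_j` to a negative root. The
    -- exchange property then yields a shorter word for the same element.
    have hneg : ¬ b.IsPos (P.weylGroupToPerm (wordProd b t) j) := by
      have := hw j (b.isPos_of_mem_support j.2)
      rw [hcat, map_mul, Equiv.Perm.mul_apply, toPerm_ofIdx] at this
      intro hpos
      have h1 : P.weylGroupToPerm (wordProd b t) (P.reflectionPerm j j) =
          P.reflectionPerm (P.weylGroupToPerm (wordProd b t) j)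
            (P.weylGroupToPerm (wordProd b t) j) := by
        apply P.root.injective
        rw [← RootPairing.weylGroup_apply_root, P.root_reflectionPerm, P.root_reflectionPerm,
          P.reflection_apply_self, P.reflection_apply_self, smul_neg,
          RootPairing.weylGroup_apply_root]
      rw [h1, isPos_reflectionPerm_self] at this
      exact this hpos
    obtain ⟨m, hm, hmeq⟩ := exchange hP b j t hneg
    rw [hcat, hmeq] at hw ⊢
    refine ih m.length ?_ m hw rfl
    simp at h
    omega

end SimpleTransitivity

/-! ### The dual root lattice and the dual basis -/

section Lattice

variable {n : ℕ} {ι : Type*}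
  {P : RootPairing ι ℝ (EuclideanSpace ℝ (Fin n)) (EuclideanSpace ℝ (Fin n))}

/-- Generation by all coroots, not only the simple ones, makes the stability under the Weyl group
visible. -/
lemma dualRootLattice_eq_closure_range (b : P.Base) :
    dualRootLattice b = AddSubgroup.closure (Set.range P.coroot) := by
  rw [dualRootLattice, ← Submodule.span_int_eq_addSubgroupClosure,
    ← Submodule.span_int_eq_addSubgroupClosure, b.span_int_coroot_support]

lemma coroot_mem_dualRootLattice (b : P.Base) (i : ι) : P.coroot i ∈ dualRootLattice b := by
  rw [dualRootLattice_eq_closure_range]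
  exact AddSubgroup.subset_closure ⟨i, rfl⟩

lemma smul_mem_dualRootLattice (hP : IsEuclidean P) (b : P.Base) (w : P.weylGroup)
    {q : EuclideanSpace ℝ (Fin n)} (hq : q ∈ dualRootLattice b) : w • q ∈ dualRootLattice b := by
  rw [dualRootLattice_eq_closure_range] at hq
  induction hq using AddSubgroup.closure_induction with
  | mem x hx =>
    obtain ⟨i, rfl⟩ := hx
    rw [hP.smul_coroot]
    exact coroot_mem_dualRootLattice b _
  | zero => rw [smul_zero]; exact zero_mem _
  | add x y _ _ hx hy => rw [smul_add]; exact add_mem hx hy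
  | neg x _ hx => rw [smul_neg]; exact neg_mem hx

lemma exists_int_inner_root [P.IsCrystallographic] (hP : IsEuclidean P) (b : P.Base)
    {q : EuclideanSpace ℝ (Fin n)} (hq : q ∈ dualRootLattice b) (k : ι) :
    ∃ m : ℤ, ⟪q, P.root k⟫ = m := by
  rw [dualRootLattice_eq_closure_range] at hq
  induction hq using AddSubgroup.closure_induction with
  | mem x hx =>
    obtain ⟨i, rfl⟩ := hx
    refine ⟨P.pairingIn ℤ k i, ?_⟩
    rw [real_inner_comm, hP.inner_root_coroot, ← P.algebraMap_pairingIn ℤ]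
    simp
  | zero => exact ⟨0, by simp⟩
  | add x y _ _ hx hy =>
    obtain ⟨k, hk⟩ := hx
    obtain ⟨l, hl⟩ := hy
    exact ⟨k + l, by rw [inner_add_left, hk, hl]; push_cast; rfl⟩
  | neg x _ hx =>
    obtain ⟨k, hk⟩ := hx
    exact ⟨-k, by rw [inner_neg_left, hk]; push_cast; rfl⟩

variable [P.IsRootSystem]

lemma dualRootLattice_eq_span (b : P.Base) :
    dualRootLattice b = (Submodule.span ℤ (Set.range b.toCoweightBasis)).toAddSubgroup := by
  rw [dualRootLattice, Submodule.span_int_eq_addSubgroupClosure]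
  congr 1
  ext x
  simp

lemma finite_dualRootLattice_inter (b : P.Base) {s : Set (EuclideanSpace ℝ (Fin n))}
    (hs : Bornology.IsBounded s) : {q | q ∈ dualRootLattice b ∧ q ∈ s}.Finite := by
  rw [dualRootLattice_eq_span b]
  refine (ZSpan.setFinite_inter b.toCoweightBasis hs).subset ?_
  rintro q ⟨h, h'⟩
  exact ⟨h', h⟩

instance countable_dualRootLattice (b : P.Base) : Countable (dualRootLattice b) := by
  rw [dualRootLattice_eq_span b]
  exact inferInstanceAs (Countable (Submodule.span ℤ (Set.range b.toCoweightBasis)))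

lemma ext_inner_root (b : P.Base) {x y : EuclideanSpace ℝ (Fin n)}
    (h : ∀ i : b.support, ⟪x, P.root i⟫ = ⟪y, P.root i⟫) : x = y :=
  InnerProductSpace.ext_inner_right_basis b.toWeightBasis fun i => by simpa using h i

lemma inner_root_eq_sum [Finite ι] (b : P.Base) (x : EuclideanSpace ℝ (Fin n)) (k : ι) :
    ⟪x, P.root k⟫ = ∑ j, b.toWeightBasis.repr (P.root k) j * ⟪x, P.root j⟫ := by
  conv_lhs => rw [← sum_repr_smul_root b (P.root k)]
  simp [inner_sum, inner_smul_right]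

lemma inner_sum_omegaCheck (hP : IsEuclidean P) (b : P.Base) (y : b.support → ℝ)
    (j : b.support) : ⟪∑ i, y i • omegaCheck b i, P.root j⟫ = y j := by
  classical
  simp [sum_inner, inner_smul_left, inner_root_omegaCheck hP]

lemma eq_sum_omegaCheck (hP : IsEuclidean P) (b : P.Base) (x : EuclideanSpace ℝ (Fin n)) :
    x = ∑ i : b.support, ⟪x, P.root i⟫ • omegaCheck b i :=
  ext_inner_root b fun j => by rw [inner_sum_omegaCheck hP]

end Lattice

/-! ### The affine Weyl group and its fundamental alcove -/

section Alcove

variable {n : ℕ} {ι : Type*} [Finite ι] [Nonempty ι]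
  {P : RootPairing ι ℝ (EuclideanSpace ℝ (Fin n)) (EuclideanSpace ℝ (Fin n))}

/-- The open fundamental alcove. -/
def alcove (b : P.Base) : Set (EuclideanSpace ℝ (Fin n)) :=
  {x | (∀ i : b.support, 0 < ⟪x, P.root i⟫) ∧ ⟪x, P.root (highestIdx b)⟫ < 1}

variable [P.IsRootSystem]

lemma mem_fundamentalDomain_iff (hP : IsEuclidean P) (b : P.Base)
    {x : EuclideanSpace ℝ (Fin n)} : x ∈ fundamentalDomain b ↔
      (∀ i : b.support, 0 ≤ ⟪x, P.root i⟫) ∧ ⟪x, P.root (highestIdx b)⟫ ≤ 1 := by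
  constructor
  · rintro ⟨y₀, y, h0, hy, h1, rfl⟩
    refine ⟨fun i => by rw [inner_sum_omegaCheck hP]; exact hy i, ?_⟩
    rw [inner_root_eq_sum b]
    simp only [inner_sum_omegaCheck hP]
    simp only [mark, mul_comm] at h1 ⊢
    linarith
  · rintro ⟨h, h1⟩
    refine ⟨1 - ⟪x, P.root (highestIdx b)⟫, fun i => ⟪x, P.root i⟫, by linarith, h, ?_,
      eq_sum_omegaCheck hP b x⟩
    rw [inner_root_eq_sum b]
    simp [mark, mul_comm]

lemma alcove_subset_fundamentalDomain (hP : IsEuclidean P) (b : P.Base) :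
    alcove b ⊆ fundamentalDomain b := fun _ hx =>
  (mem_fundamentalDomain_iff hP b).2 ⟨fun i => (hx.1 i).le, hx.2.le⟩

variable [P.IsCrystallographic] [P.IsReduced] [P.IsIrreducible]

lemma mark_pos (b : P.Base) (i : b.support) : 0 < mark b i := repr_highestIdx_pos b i

lemma alcove_nonempty (hP : IsEuclidean P) (b : P.Base) : (alcove b).Nonempty := by
  have hs : 0 ≤ ∑ i, mark b i := Finset.sum_nonneg fun i _ => (mark_pos b i).le
  -- With all coordinates equal to `1/(1 + ∑ mᵢ)`, the highest root takes the value `∑ mᵢ/(1 + ∑ mᵢ)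
  -- < 1`.
  refine ⟨∑ i, (1 / (1 + ∑ i, mark b i)) • omegaCheck b i, fun i => ?_, ?_⟩
  · rw [inner_sum_omegaCheck hP b (fun _ => 1 / (1 + ∑ i, mark b i))]
    positivity
  · rw [inner_root_eq_sum b]
    simp only [inner_sum_omegaCheck hP b (fun _ => 1 / (1 + ∑ i, mark b i))]
    rw [← Finset.sum_mul]
    change (∑ i, mark b i) * _ < 1
    rw [mul_one_div, div_lt_one (by positivity)]
    linarith

lemma inner_root_mem_Icc (hP : IsEuclidean P) (b : P.Base) {x : EuclideanSpace ℝ (Fin n)}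
    (hx : x ∈ fundamentalDomain b) {k : ι} (hk : b.IsPos k) :
    0 ≤ ⟪x, P.root k⟫ ∧ ⟪x, P.root k⟫ ≤ 1 := by
  obtain ⟨h0, h1⟩ := (mem_fundamentalDomain_iff hP b).1 hx
  constructor
  · rw [inner_root_eq_sum b]
    exact Finset.sum_nonneg fun j _ => mul_nonneg (repr_nonneg_of_isPos b hk j) (h0 j)
  · refine le_trans ?_ h1
    rw [inner_root_eq_sum b, inner_root_eq_sum b x (highestIdx b)]
    exact Finset.sum_le_sum fun j _ =>
      mul_le_mul_of_nonneg_right (repr_le_repr_highestIdx b k j) (h0 j)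

lemma inner_root_mem_Ioo (b : P.Base) {x : EuclideanSpace ℝ (Fin n)}
    (hx : x ∈ alcove b) {k : ι} (hk : b.IsPos k) :
    0 < ⟪x, P.root k⟫ ∧ ⟪x, P.root k⟫ < 1 := by
  obtain ⟨h0, h1⟩ := hx
  constructor
  · rw [inner_root_eq_sum b]
    obtain ⟨j, hj⟩ : ∃ j, b.toWeightBasis.repr (P.root k) j ≠ 0 := by
      by_contra! h
      apply P.ne_zero k
      rw [← sum_repr_smul_root b (P.root k)]
      simp [h]
    refine Finset.sum_pos' (fun j _ => mul_nonneg (repr_nonneg_of_isPos b hk j) (h0 j).le)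
      ⟨j, Finset.mem_univ _, mul_pos ((repr_nonneg_of_isPos b hk j).lt_of_ne' hj) (h0 j)⟩
  · refine lt_of_le_of_lt ?_ h1
    rw [inner_root_eq_sum b, inner_root_eq_sum b x (highestIdx b)]
    exact Finset.sum_le_sum fun j _ =>
      mul_le_mul_of_nonneg_right (repr_le_repr_highestIdx b k j) (h0 j).le

omit [Finite ι] [Nonempty ι] [P.IsRootSystem] [P.IsCrystallographic] [P.IsReduced]
  [P.IsIrreducible] in
lemma root_reflectionPerm_self (k : ι) : P.root (P.reflectionPerm k k) = -P.root k := by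
  rw [P.root_reflectionPerm, P.reflection_apply_self]

/-- A root is confined to the same unit interval on the open alcove and on its closure. -/
lemma exists_int_interval (hP : IsEuclidean P) (b : P.Base) {x p : EuclideanSpace ℝ (Fin n)}
    (hx : x ∈ fundamentalDomain b) (hp : p ∈ alcove b) (k : ι) :
    ∃ e : ℤ, (e < ⟪p, P.root k⟫ ∧ ⟪p, P.root k⟫ < e + 1) ∧
      (e ≤ ⟪x, P.root k⟫ ∧ ⟪x, P.root k⟫ ≤ e + 1) := by
  by_cases hk : b.IsPos k
  · exact ⟨0, by simpa using inner_root_mem_Ioo b hp hk,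
      by simpa using inner_root_mem_Icc hP b hx hk⟩
  · rw [← isPos_reflectionPerm_self] at hk
    have h1 := inner_root_mem_Ioo b hp hk
    have h2 := inner_root_mem_Icc hP b hx hk
    rw [root_reflectionPerm_self, inner_neg_right] at h1 h2
    refine ⟨-1, ⟨?_, ?_⟩, ?_, ?_⟩ <;> push_cast <;> linarith [h1.1, h1.2, h2.1, h2.2]

omit [Finite ι] [Nonempty ι] [P.IsRootSystem] [P.IsCrystallographic] [P.IsReduced]
  [P.IsIrreducible] in
lemma inner_smul_add_root (hP : IsEuclidean P) (w : P.weylGroup)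
    (x q : EuclideanSpace ℝ (Fin n)) (k : ι) :
    ⟪w • x + q, P.root k⟫ = ⟪x, P.root (P.weylGroupToPerm w⁻¹ k)⟫ + ⟪q, P.root k⟫ := by
  rw [inner_add_left, hP.inner_smul_left_eq, RootPairing.weylGroup_apply_root]

lemma exists_int_interval_affine (hP : IsEuclidean P) (b : P.Base)
    {x p q : EuclideanSpace ℝ (Fin n)} (hx : x ∈ fundamentalDomain b) (hp : p ∈ alcove b)
    (w : P.weylGroup) (hq : q ∈ dualRootLattice b) (k : ι) :
    ∃ e : ℤ, (e < ⟪w • p + q, P.root k⟫ ∧ ⟪w • p + q, P.root k⟫ < e + 1) ∧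
      (e ≤ ⟪w • x + q, P.root k⟫ ∧ ⟪w • x + q, P.root k⟫ ≤ e + 1) := by
  obtain ⟨m, hm⟩ := exists_int_inner_root hP b hq k
  obtain ⟨e, h1, h2⟩ := exists_int_interval hP b hx hp (P.weylGroupToPerm w⁻¹ k)
  simp only [inner_smul_add_root hP, hm]
  refine ⟨e + m, ⟨?_, ?_⟩, ?_, ?_⟩ <;> push_cast <;> linarith [h1.1, h1.2, h2.1, h2.2]

omit [Finite ι] [Nonempty ι] [P.IsRootSystem] [P.IsCrystallographic] [P.IsReduced]
  [P.IsIrreducible] in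
/-- Reflecting a point in a hyperplane that separates it from `p` brings it closer to `p`. -/
lemma norm_reflection_sub_lt (hP : IsEuclidean P) (k : ι) (c : ℝ)
    {y p : EuclideanSpace ℝ (Fin n)}
    (h : (⟪y, P.root k⟫ - c) * (⟪p, P.root k⟫ - c) < 0) :
    ‖y - (⟪y, P.root k⟫ - c) • P.coroot k - p‖ < ‖y - p‖ := by
  have h0 : 0 < ⟪P.root k, P.root k⟫ := real_inner_self_pos.2 (P.ne_zero k)
  rw [← sq_lt_sq₀ (norm_nonneg _) (norm_nonneg _), sub_right_comm, @norm_sub_sq_real,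
    ← real_inner_self_eq_norm_sq (_ • _), hP.coroot_eq]
  simp only [inner_smul_left, inner_smul_right, inner_sub_left, conj_trivial]
  -- The squared distance to `p` changes by `4/⟨α, α⟩` times the product in the hypothesis.
  have : ‖y - p‖ ^ 2 - 2 * ((⟪y, P.root k⟫ - c) * (2 / ⟪P.root k, P.root k⟫ *
      (⟪y, P.root k⟫ - ⟪p, P.root k⟫))) + (⟪y, P.root k⟫ - c) * ((⟪y, P.root k⟫ - c) *
      (2 / ⟪P.root k, P.root k⟫ * (2 / ⟪P.root k, P.root k⟫ * ⟪P.root k, P.root k⟫))) =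
      ‖y - p‖ ^ 2 + 4 / ⟪P.root k, P.root k⟫ * ((⟪y, P.root k⟫ - c) * (⟪p, P.root k⟫ - c)) := by
    field_simp
    ring
  have h2 : 4 / ⟪P.root k, P.root k⟫ * ((⟪y, P.root k⟫ - c) * (⟪p, P.root k⟫ - c)) < 0 :=
    mul_neg_of_pos_of_neg (by positivity) h
  refine lt_of_eq_of_lt ?_ (lt_of_eq_of_lt this (by linarith))
  ring

omit [Nonempty ι] [P.IsCrystallographic] [P.IsReduced] [P.IsIrreducible] in
-- The minimum is attained because the Weyl group is finite and only finitely many lattice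
-- translations keep the image within a given distance of `p`.
lemma exists_nearest (hP : IsEuclidean P) (b : P.Base)
    (S : Set (P.weylGroup × EuclideanSpace ℝ (Fin n)))
    (hS : ∀ g ∈ S, g.2 ∈ dualRootLattice b) (hne : S.Nonempty) (x p : EuclideanSpace ℝ (Fin n)) :
    ∃ g ∈ S, ∀ h ∈ S, ‖g.1 • x + g.2 - p‖ ≤ ‖h.1 • x + h.2 - p‖ := by
  obtain ⟨g₀, hg₀⟩ := hne
  set R := ‖g₀.1 • x + g₀.2 - p‖ with hR
  have hfin : {g ∈ S | ‖g.1 • x + g.2 - p‖ ≤ R}.Finite := by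
    refine ((Set.finite_univ (α := P.weylGroup)).prod
      (finite_dualRootLattice_inter b
        (Metric.isBounded_closedBall (x := 0) (r := R + ‖x‖ + ‖p‖)))).subset ?_
    rintro ⟨w, q⟩ ⟨hg, hle⟩
    refine ⟨trivial, hS _ hg, ?_⟩
    rw [mem_closedBall_zero_iff]
    simp only at hle ⊢
    calc ‖q‖ = ‖(w • x + q - p) - w • x + p‖ := by congr 1; abel
      _ ≤ ‖w • x + q - p‖ + ‖w • x‖ + ‖p‖ :=
        (norm_add_le _ _).trans (add_le_add_left (norm_sub_le _ _) _)
      _ ≤ R + ‖x‖ + ‖p‖ := by rw [hP.norm_smul]; linarith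
  obtain ⟨g, hg, hmin⟩ := Set.exists_min_image _ (fun g => ‖g.1 • x + g.2 - p‖) hfin
    ⟨g₀, hg₀, le_rfl⟩
  refine ⟨g, hg.1, fun h hh => ?_⟩
  by_cases hle : ‖h.1 • x + h.2 - p‖ ≤ R
  · exact hmin h ⟨hh, hle⟩
  · exact hg.2.trans (not_le.1 hle).le

omit [Finite ι] [Nonempty ι] [P.IsRootSystem] [P.IsCrystallographic] [P.IsReduced]
  [P.IsIrreducible] in
lemma reflection_affine (hP : IsEuclidean P) (w : P.weylGroup) (x q : EuclideanSpace ℝ (Fin n))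
    (k : ι) (c : ℤ) :
    (RootPairing.weylGroup.ofIdx P k * w) • x +
      (RootPairing.weylGroup.ofIdx P k • q + c • P.coroot k) =
    (w • x + q) - (⟪w • x + q, P.root k⟫ - c) • P.coroot k := by
  rw [mul_smul, ← add_assoc, ← smul_add, ofIdx_smul_eq hP, sub_smul, Int.cast_smul_eq_zsmul]
  abel

omit [Finite ι] [Nonempty ι] [P.IsRootSystem] [P.IsCrystallographic] [P.IsReduced]
  [P.IsIrreducible] in
lemma reflection_translation_mem (hP : IsEuclidean P) (b : P.Base)
    {q : EuclideanSpace ℝ (Fin n)} (hq : q ∈ dualRootLattice b) (k : ι) (c : ℤ) :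
    RootPairing.weylGroup.ofIdx P k • q + c • P.coroot k ∈ dualRootLattice b :=
  add_mem (smul_mem_dualRootLattice hP b _ hq) (zsmul_mem (coroot_mem_dualRootLattice b k) c)

/-- Every point is conjugate under the affine Weyl group to a point of the fundamental domain. -/
lemma exists_smul_add_mem_fundamentalDomain (hP : IsEuclidean P) (b : P.Base)
    (x : EuclideanSpace ℝ (Fin n)) :
    ∃ w : P.weylGroup, ∃ q ∈ dualRootLattice b, w • x + q ∈ fundamentalDomain b := by
  obtain ⟨p, hp⟩ := alcove_nonempty hP b
  -- No wall separates the conjugate of `x` nearest to the interior point `p` from `p`, since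
  -- reflecting in such a wall would bring it closer.
  obtain ⟨⟨w, q⟩, hq, hmin⟩ := exists_nearest hP b {g | g.2 ∈ dualRootLattice b} (fun _ h => h)
    ⟨(1, 0), zero_mem (dualRootLattice b)⟩ x p
  simp only [Set.mem_ofPred_eq] at hq hmin
  refine ⟨w, q, hq, ?_⟩
  have key : ∀ (k : ι) (c : ℤ),
      ¬ (⟪w • x + q, P.root k⟫ - c) * (⟪p, P.root k⟫ - c) < 0 := by
    intro k c h
    have h1 := norm_reflection_sub_lt hP k c h
    have h2 := hmin ⟨RootPairing.weylGroup.ofIdx P k * w,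
      RootPairing.weylGroup.ofIdx P k • q + c • P.coroot k⟩ (reflection_translation_mem hP b hq k c)
    rw [reflection_affine hP] at h2
    exact absurd h1 (not_lt.2 h2)
  rw [mem_fundamentalDomain_iff hP]
  constructor
  · intro i
    by_contra! h
    refine key i 0 ?_
    have := hp.1 i
    simpa using mul_neg_of_neg_of_pos h this
  · by_contra! h
    refine key (highestIdx b) 1 ?_
    have := hp.2
    push_cast
    exact mul_neg_of_pos_of_neg (by linarith) (by linarith)

omit [Nonempty ι] [P.IsRootSystem] [P.IsReduced] [P.IsIrreducible] in
lemma eq_zero_of_forall_inner_root_lt_two (hP : IsEuclidean P) (b : P.Base)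
    {q : EuclideanSpace ℝ (Fin n)} (hq : q ∈ dualRootLattice b)
    (h : ∀ k, ⟪q, P.root k⟫ < 2) : q = 0 := by
  by_contra h0
  rw [dualRootLattice_eq_closure_range] at hq
  obtain ⟨k, hk⟩ := exists_two_le_pairing (P := P.flip) hq h0
  rw [hP.flip.toLinearMap_apply] at hk
  exact absurd hk (not_le.2 (h k))

/-- The affine Weyl group acts freely on the alcoves. -/
lemma eq_one_of_alcove (hP : IsEuclidean P) (b : P.Base) {w : P.weylGroup}
    {p q : EuclideanSpace ℝ (Fin n)} (hq : q ∈ dualRootLattice b) (hp : p ∈ alcove b)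
    (hz : w • p + q ∈ alcove b) : w = 1 ∧ q = 0 := by
  have habs : ∀ {x : EuclideanSpace ℝ (Fin n)}, x ∈ alcove b → ∀ k, |⟪x, P.root k⟫| < 1 := by
    intro x hx k
    rw [abs_lt]
    by_cases hk : b.IsPos k
    · have := inner_root_mem_Ioo b hx hk
      constructor <;> linarith [this.1, this.2]
    · rw [← isPos_reflectionPerm_self] at hk
      have := inner_root_mem_Ioo b hx hk
      rw [root_reflectionPerm_self, inner_neg_right] at this
      constructor <;> linarith [this.1, this.2]
  -- Root values at both alcove points lie in `(-1, 1)`, so those of the translation `q` are less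
  -- than `2`.
  have hq0 : q = 0 := by
    refine eq_zero_of_forall_inner_root_lt_two hP b hq fun k => ?_
    have h1 := habs hz k
    have h2 := habs hp (P.weylGroupToPerm w⁻¹ k)
    rw [inner_smul_add_root hP] at h1
    rw [abs_lt] at h1 h2
    linarith [h1.1, h1.2, h2.1, h2.2]
  refine ⟨?_, hq0⟩
  rw [← inv_eq_one]
  -- With `q = 0`, both `p` and `w • p` are positive on all positive roots, so `w⁻¹` preserves
  -- positivity.
  refine eq_one_of_forall_isPos hP b _ fun k hk => ?_
  by_contra hneg
  rw [← isPos_reflectionPerm_self] at hneg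
  have h1 := inner_root_mem_Ioo b hz hk
  have h2 := inner_root_mem_Ioo b hp hneg
  rw [inner_smul_add_root hP, hq0, inner_zero_left] at h1
  rw [root_reflectionPerm_self, inner_neg_right] at h2
  linarith [h1.1, h2.1]

/-- Points of the fundamental domain that are conjugate under the affine Weyl group are equal. -/
lemma eq_of_mem_fundamentalDomain (hP : IsEuclidean P) (b : P.Base) {w₀ : P.weylGroup}
    {x y q₀ : EuclideanSpace ℝ (Fin n)} (hq₀ : q₀ ∈ dualRootLattice b)
    (hx : x ∈ fundamentalDomain b) (hy : y ∈ fundamentalDomain b) (hxy : w₀ • x + q₀ = y) :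
    x = y := by
  obtain ⟨p, hp⟩ := alcove_nonempty hP b
  -- Among the affine elements carrying `x` to `y`, take one moving `p` least. Reflections in walls
  -- through `y` may be composed with it, so no wall through `y` separates the image of `p` from
  -- `p`.
  obtain ⟨⟨w, q⟩, ⟨hq, hwq⟩, hmin⟩ := exists_nearest hP b
    {g | g.2 ∈ dualRootLattice b ∧ g.1 • x + g.2 = y} (fun _ h => h.1) ⟨(w₀, q₀), hq₀, hxy⟩ p p
  simp only [Set.mem_ofPred_eq] at hq hmin hwq
  have key : ∀ (k : ι) (c : ℤ), ⟪y, P.root k⟫ = c →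
      ¬ (⟪w • p + q, P.root k⟫ - c) * (⟪p, P.root k⟫ - c) < 0 := by
    intro k c hc h
    have h1 := norm_reflection_sub_lt hP k c h
    have h2 := hmin ⟨RootPairing.weylGroup.ofIdx P k * w,
      RootPairing.weylGroup.ofIdx P k • q + c • P.coroot k⟩
      ⟨reflection_translation_mem hP b hq k c, by
        simp only [reflection_affine hP, hwq, hc, sub_self, zero_smul, sub_zero]⟩
    rw [reflection_affine hP] at h2
    exact absurd h1 (not_lt.2 h2)
  obtain ⟨hy0, hy1⟩ := (mem_fundamentalDomain_iff hP b).1 hy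
  have hz : w • p + q ∈ alcove b := by
    constructor
    · intro i
      -- The image of `p` and `y` lie in one strip between consecutive walls. If that image violated
      -- this inequality, `y ∈ F` would be forced onto the wall, which `key` excludes.
      obtain ⟨e, ⟨h1, h2⟩, h3, h4⟩ := exists_int_interval_affine hP b hx hp w hq i
      rw [hwq] at h3 h4
      by_contra! hle
      have he : e ≤ -1 := by
        have : (e : ℝ) < 0 := by linarith
        have : e < 0 := by exact_mod_cast this
        omega
      have he' : (e : ℝ) ≤ -1 := by exact_mod_cast he
      have hyi : ⟪y, P.root i⟫ = ((0 : ℤ) : ℝ) := by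
        push_cast
        exact le_antisymm (by linarith) (hy0 i)
      have he2 : e = -1 := by
        have : (-1 : ℝ) ≤ e := by push_cast at hyi; linarith
        have : (-1 : ℤ) ≤ e := by exact_mod_cast this
        omega
      refine key i 0 hyi ?_
      have := hp.1 i
      subst he2
      push_cast at h2 ⊢
      exact mul_neg_of_neg_of_pos (by linarith) (by linarith)
    · obtain ⟨e, ⟨h1, h2⟩, h3, h4⟩ := exists_int_interval_affine hP b hx hp w hq (highestIdx b)
      rw [hwq] at h3 h4
      by_contra! hle
      have he : 1 ≤ e := by
        have : (0 : ℝ) < e := by linarith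
        have : 0 < e := by exact_mod_cast this
        omega
      have he' : (1 : ℝ) ≤ e := by exact_mod_cast he
      have hyi : ⟪y, P.root (highestIdx b)⟫ = ((1 : ℤ) : ℝ) := by
        push_cast
        exact le_antisymm hy1 (by linarith)
      refine key _ 1 hyi ?_
      have := hp.2
      push_cast
      exact mul_neg_of_pos_of_neg (by linarith) (by linarith)
  obtain ⟨rfl, rfl⟩ := eq_one_of_alcove hP b hq hp hz
  simpa using hwq

end Alcove

/-! ### Plane waves -/

section PlaneWave

variable {n : ℕ}

/-- The exponential `x ↦ e^{2πi⟨ν, x⟩}`. -/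
def planeWave (ν x : EuclideanSpace ℝ (Fin n)) : ℂ :=
  Complex.exp (2 * Real.pi * Complex.I * (⟪ν, x⟫ : ℝ))

lemma planeWave_add (ν x y : EuclideanSpace ℝ (Fin n)) :
    planeWave ν (x + y) = planeWave ν x * planeWave ν y := by
  rw [planeWave, planeWave, planeWave, ← Complex.exp_add, inner_add_right]
  push_cast
  ring_nf

lemma planeWave_eq_one_iff (ν x : EuclideanSpace ℝ (Fin n)) :
    planeWave ν x = 1 ↔ ∃ m : ℤ, ⟪ν, x⟫ = m := by
  rw [planeWave, Complex.exp_eq_one_iff]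
  refine exists_congr fun m => ?_
  rw [show (2 * Real.pi * Complex.I * (⟪ν, x⟫ : ℝ) : ℂ) = (⟪ν, x⟫ : ℝ) * (2 * Real.pi * Complex.I)
    by ring, mul_left_inj' Complex.two_pi_I_ne_zero]
  exact_mod_cast Iff.rfl

lemma continuous_planeWave (ν : EuclideanSpace ℝ (Fin n)) : Continuous (planeWave ν) := by
  unfold planeWave
  fun_prop

lemma exists_planeWave_ne_one {ν : EuclideanSpace ℝ (Fin n)} (hν : ν ≠ 0) :
    ∃ v, planeWave ν v ≠ 1 := by
  -- This vector pairs with `ν` to `1/2`, which is not an integer.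
  refine ⟨(1 / (2 * ⟪ν, ν⟫)) • ν, fun h => ?_⟩
  obtain ⟨m, hm⟩ := (planeWave_eq_one_iff _ _).1 h
  have h0 : ⟪ν, ν⟫ ≠ 0 := inner_self_ne_zero.2 hν
  rw [inner_smul_right, show 1 / (2 * ⟪ν, ν⟫) * ⟪ν, ν⟫ = 1 / 2 by field_simp] at hm
  have : (1 : ℝ) = ((2 * m : ℤ) : ℝ) := by push_cast; linarith
  have : (1 : ℤ) = 2 * m := by exact_mod_cast this
  omega

end PlaneWave

/-! ### Invariance of orbit functions under the affine Weyl group -/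

section OrbitFunction

variable {n : ℕ} {ι : Type*} [Finite ι]
  {P : RootPairing ι ℝ (EuclideanSpace ℝ (Fin n)) (EuclideanSpace ℝ (Fin n))} [P.IsRootSystem]

lemma orbitFunction_eq (lam x : EuclideanSpace ℝ (Fin n)) :
    orbitFunction (P := P) lam x =
      ∑ ν ∈ (finite_orbit (P := P) lam).toFinset, planeWave ν x := rfl

lemma continuous_orbitFunction (lam : EuclideanSpace ℝ (Fin n)) :
    Continuous (orbitFunction (P := P) lam) :=
  continuous_finsetSum _ fun ν _ => continuous_planeWave ν

lemma orbitFunction_smul (hP : IsEuclidean P) (lam x : EuclideanSpace ℝ (Fin n))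
    (w : P.weylGroup) : orbitFunction (P := P) lam (w • x) = orbitFunction (P := P) lam x := by
  rw [orbitFunction_eq, orbitFunction_eq]
  refine Finset.sum_bij' (fun ν _ => w⁻¹ • ν) (fun ν _ => w • ν) ?_ ?_ ?_ ?_ ?_
  · intro ν hν
    rw [Set.Finite.mem_toFinset] at hν ⊢
    exact MulAction.mem_orbit_of_mem_orbit _ hν
  · intro ν hν
    rw [Set.Finite.mem_toFinset] at hν ⊢
    exact MulAction.mem_orbit_of_mem_orbit _ hν
  · intro ν _; exact smul_inv_smul _ _
  · intro ν _; exact inv_smul_smul _ _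
  · intro ν _
    rw [planeWave, planeWave, hP.inner_smul_left_eq, inv_inv]

lemma orbitFunction_zero (x : EuclideanSpace ℝ (Fin n)) :
    orbitFunction (P := P) 0 x = 1 := by
  have : (finite_orbit (P := P) (0 : EuclideanSpace ℝ (Fin n))).toFinset = {0} := by
    ext ν
    rw [Set.Finite.mem_toFinset, Finset.mem_singleton, MulAction.mem_orbit_iff]
    simp only [smul_zero, exists_const, eq_comm]
  rw [orbitFunction_eq, this, Finset.sum_singleton]
  simp [planeWave]

omit [Finite ι] [P.IsRootSystem] in
lemma ne_zero_of_mem_orbit {lam ν : EuclideanSpace ℝ (Fin n)} (h0 : lam ≠ 0)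
    (hν : ν ∈ MulAction.orbit P.weylGroup lam) : ν ≠ 0 := by
  obtain ⟨w, rfl⟩ := hν
  exact (smul_ne_zero_iff_ne w).2 h0

omit [Finite ι] in
lemma exists_nat_inner_coroot (hP : IsEuclidean P) (b : P.Base) {lam : EuclideanSpace ℝ (Fin n)}
    (hlam : lam ∈ positiveWeights b) (i : b.support) : ∃ k : ℕ, ⟪lam, P.coroot i⟫ = k := by
  classical
  obtain ⟨k, rfl⟩ := hlam
  refine ⟨k i, ?_⟩
  simp [sum_inner, inner_smul_left, inner_omega_coroot hP]

omit [Finite ι] in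
lemma exists_int_inner_of_mem_positiveWeights (hP : IsEuclidean P) (b : P.Base)
    {lam q : EuclideanSpace ℝ (Fin n)} (hlam : lam ∈ positiveWeights b)
    (hq : q ∈ dualRootLattice b) : ∃ m : ℤ, ⟪lam, q⟫ = m := by
  rw [dualRootLattice] at hq
  induction hq using AddSubgroup.closure_induction with
  | mem x hx =>
    obtain ⟨i, hi, rfl⟩ := hx
    obtain ⟨k, hk⟩ := exists_nat_inner_coroot hP b hlam ⟨i, hi⟩
    exact ⟨k, by simpa using hk⟩
  | zero => exact ⟨0, by simp⟩
  | add x y _ _ hx hy =>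
    obtain ⟨k, hk⟩ := hx
    obtain ⟨l, hl⟩ := hy
    exact ⟨k + l, by rw [inner_add_right, hk, hl]; push_cast; rfl⟩
  | neg x _ hx =>
    obtain ⟨k, hk⟩ := hx
    exact ⟨-k, by rw [inner_neg_right, hk]; push_cast; rfl⟩

omit [Finite ι] in
lemma planeWave_eq_one_of_mem_orbit (hP : IsEuclidean P) (b : P.Base)
    {lam ν q : EuclideanSpace ℝ (Fin n)} (hlam : lam ∈ positiveWeights b)
    (hν : ν ∈ MulAction.orbit P.weylGroup lam) (hq : q ∈ dualRootLattice b) :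
    planeWave ν q = 1 := by
  obtain ⟨w, rfl⟩ := hν
  rw [planeWave_eq_one_iff]
  simp only [hP.inner_smul_left_eq]
  exact exists_int_inner_of_mem_positiveWeights hP b hlam (smul_mem_dualRootLattice hP b _ hq)

lemma orbitFunction_add (hP : IsEuclidean P) (b : P.Base)
    {lam q : EuclideanSpace ℝ (Fin n)} (hlam : lam ∈ positiveWeights b)
    (hq : q ∈ dualRootLattice b) (x : EuclideanSpace ℝ (Fin n)) :
    orbitFunction (P := P) lam (x + q) = orbitFunction (P := P) lam x := by
  refine Finset.sum_congr rfl fun ν hν => ?_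
  rw [Set.Finite.mem_toFinset] at hν
  refine (planeWave_add ν x q).trans ?_
  rw [planeWave_eq_one_of_mem_orbit hP b hlam hν hq, mul_one]
  rfl

end OrbitFunction

/-! ### The integral of an orbit function over the fundamental domain -/

section Hyperplanes

variable {n : ℕ} {ι : Type*}
  {P : RootPairing ι ℝ (EuclideanSpace ℝ (Fin n)) (EuclideanSpace ℝ (Fin n))}

/-- The union of the reflection hyperplanes of the affine Weyl group. -/
def walls (P : RootPairing ι ℝ (EuclideanSpace ℝ (Fin n)) (EuclideanSpace ℝ (Fin n))) :
    Set (EuclideanSpace ℝ (Fin n)) :=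
  ⋃ (k : ι) (c : ℤ), {x | ⟪x, P.root k⟫ = c}

lemma volume_setOf_inner_eq {v : EuclideanSpace ℝ (Fin n)} (hv : v ≠ 0) (c : ℝ) :
    volume {x : EuclideanSpace ℝ (Fin n) | ⟪x, v⟫ = c} = 0 := by
  have h0 : ⟪v, v⟫ ≠ 0 := inner_self_ne_zero.2 hv
  have : {x : EuclideanSpace ℝ (Fin n) | ⟪x, v⟫ = c} =
      (fun x => x + -((c / ⟪v, v⟫) • v)) ⁻¹' ((innerSL ℝ v).ker : Set _) := by
    ext x
    simp only [Set.mem_ofPred_eq, Set.mem_preimage, SetLike.mem_coe, LinearMap.mem_ker,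
      ContinuousLinearMap.coe_coe, innerSL_apply_apply, inner_add_right, inner_neg_right,
      inner_smul_right, real_inner_comm v x]
    rw [div_mul_cancel₀ _ h0, ← sub_eq_add_neg, sub_eq_zero, eq_comm, real_inner_comm, eq_comm]
  rw [this, measure_preimage_add_right]
  refine Measure.addHaar_submodule _ _ fun h => h0 ?_
  have : v ∈ (innerSL ℝ v).ker := h ▸ Submodule.mem_top
  simpa using this

lemma volume_walls [Finite ι] : volume (walls P) = 0 :=
  measure_iUnion_null fun k => measure_iUnion_null fun c =>
    volume_setOf_inner_eq (P.ne_zero k) c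

lemma notMem_walls_smul_add [P.IsCrystallographic] (hP : IsEuclidean P) (b : P.Base)
    {x q : EuclideanSpace ℝ (Fin n)} (hq : q ∈ dualRootLattice b) (w : P.weylGroup)
    (hx : x ∉ walls P) : w • x + q ∉ walls P := by
  simp only [walls, Set.mem_iUnion, Set.mem_ofPred_eq, not_exists] at hx ⊢
  intro k c h
  obtain ⟨m, hm⟩ := exists_int_inner_root hP b hq k
  rw [inner_smul_add_root hP, hm] at h
  refine hx (P.weylGroupToPerm w⁻¹ k) (c - m) ?_
  push_cast
  linarith

variable [Finite ι] [Nonempty ι] [P.IsRootSystem]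

lemma mem_alcove_of_notMem_walls (hP : IsEuclidean P) (b : P.Base) {x : EuclideanSpace ℝ (Fin n)}
    (hx : x ∈ fundamentalDomain b) (hw : x ∉ walls P) : x ∈ alcove b := by
  simp only [walls, Set.mem_iUnion, Set.mem_ofPred_eq, not_exists] at hw
  obtain ⟨h0, h1⟩ := (mem_fundamentalDomain_iff hP b).1 hx
  exact ⟨fun i => (h0 i).lt_of_ne' (by simpa using hw i 0),
    h1.lt_of_ne (by simpa using hw (highestIdx b) 1)⟩

lemma fundamentalDomain_ae_eq_alcove (hP : IsEuclidean P) (b : P.Base) :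
    fundamentalDomain b =ᵐ[volume] alcove b := by
  refine Filter.EventuallyLE.antisymm ?_ (alcove_subset_fundamentalDomain hP b).eventuallyLE
  have : ∀ᵐ x : EuclideanSpace ℝ (Fin n), x ∉ walls P := measure_eq_zero_iff_ae_notMem.1 volume_walls
  filter_upwards [this] with x hx hF using mem_alcove_of_notMem_walls hP b hF hx

omit [P.IsRootSystem] in
lemma isOpen_alcove (b : P.Base) : IsOpen (alcove b) := by
  have : alcove b = (⋂ i : b.support, {x | 0 < ⟪x, P.root i⟫}) ∩
      {x | ⟪x, P.root (highestIdx b)⟫ < 1} := by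
    ext x; simp [alcove]
  rw [this]
  exact (isOpen_iInter_of_finite fun i => isOpen_lt (by fun_prop) (by fun_prop)).inter
    (isOpen_lt (by fun_prop) (by fun_prop))

variable [P.IsCrystallographic] [P.IsReduced] [P.IsIrreducible]

lemma isCompact_fundamentalDomain (hP : IsEuclidean P) (b : P.Base) :
    IsCompact (fundamentalDomain b) := by
  refine Metric.isCompact_of_isClosed_isBounded ?_ ?_
  · have : fundamentalDomain b = (⋂ i : b.support, {x | 0 ≤ ⟪x, P.root i⟫}) ∩
        {x | ⟪x, P.root (highestIdx b)⟫ ≤ 1} := by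
      ext x; simp [mem_fundamentalDomain_iff hP]
    rw [this]
    exact (isClosed_iInter fun i => isClosed_le (by fun_prop) (by fun_prop)).inter
      (isClosed_le (by fun_prop) (by fun_prop))
  · refine isBounded_iff_forall_norm_le.2 ⟨∑ i, ‖omegaCheck b i‖, fun x hx => ?_⟩
    rw [eq_sum_omegaCheck hP b x]
    refine norm_sum_le_of_le _ fun i _ => ?_
    have := inner_root_mem_Icc hP b hx (b.isPos_of_mem_support i.2)
    rw [_root_.norm_smul, Real.norm_of_nonneg this.1]
    exact mul_le_of_le_one_left (norm_nonneg _) this.2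

lemma volume_real_fundamentalDomain_ne_zero (hP : IsEuclidean P) (b : P.Base) :
    volume.real (fundamentalDomain b) ≠ 0 := by
  refine (ENNReal.toReal_pos ?_ (isCompact_fundamentalDomain hP b).measure_lt_top.ne).ne'
  exact (((isOpen_alcove b).measure_pos volume (alcove_nonempty hP b)).trans_le
    (measure_mono (alcove_subset_fundamentalDomain hP b))).ne'

lemma integrableOn_fundamentalDomain (hP : IsEuclidean P) (b : P.Base)
    (lam : EuclideanSpace ℝ (Fin n)) :
    IntegrableOn (orbitFunction (P := P) lam) (fundamentalDomain b) volume :=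
  (continuous_orbitFunction lam).continuousOn.integrableOn_compact
    (isCompact_fundamentalDomain hP b)

/-- The union of the images of the open alcove under the finite Weyl group. -/
def alcoveStar (b : P.Base) : Set (EuclideanSpace ℝ (Fin n)) :=
  ⋃ w : P.weylGroup, (fun x => w • x) ⁻¹' alcove b

omit [P.IsRootSystem] [Finite ι] [Nonempty ι] [P.IsCrystallographic] [P.IsReduced]
  [P.IsIrreducible] in
lemma measurePreserving_weyl (hP : IsEuclidean P) (w : P.weylGroup) :
    MeasurePreserving (fun x : EuclideanSpace ℝ (Fin n) => w • x) volume volume :=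
  (weylIsometry hP w).measurePreserving

omit [P.IsRootSystem] [Finite ι] [Nonempty ι] [P.IsCrystallographic] [P.IsReduced]
  [P.IsIrreducible] in
lemma measurableEmbedding_weyl (hP : IsEuclidean P) (w : P.weylGroup) :
    MeasurableEmbedding (fun x : EuclideanSpace ℝ (Fin n) => w • x) :=
  (weylIsometry hP w).toHomeomorph.measurableEmbedding

omit [P.IsRootSystem] [P.IsCrystallographic] [P.IsReduced] [P.IsIrreducible] in
lemma measurableSet_weyl_preimage (hP : IsEuclidean P) (b : P.Base) (w : P.weylGroup) :
    MeasurableSet ((fun x : EuclideanSpace ℝ (Fin n) => w • x) ⁻¹' alcove b) :=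
  (measurableEmbedding_weyl hP w).measurable (isOpen_alcove b).measurableSet

open scoped Pointwise in
-- Off the null set of walls, conjugacy to a point of `F` means conjugacy to a point of the open
-- alcove, which gives the covering. Disjointness of the translates is the freeness of the affine
-- action.
lemma isAddFundamentalDomain_alcoveStar (hP : IsEuclidean P) (b : P.Base) :
    IsAddFundamentalDomain (dualRootLattice b) (alcoveStar b) volume where
  nullMeasurableSet :=
    (MeasurableSet.iUnion fun w => measurableSet_weyl_preimage hP b w).nullMeasurableSet
  ae_covers := by
    have : ∀ᵐ x : EuclideanSpace ℝ (Fin n), x ∉ walls P :=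
      measure_eq_zero_iff_ae_notMem.1 volume_walls
    filter_upwards [this] with x hx
    obtain ⟨w, q, hq, h⟩ := exists_smul_add_mem_fundamentalDomain hP b x
    refine ⟨⟨w⁻¹ • q, smul_mem_dualRootLattice hP b _ hq⟩, Set.mem_iUnion.2 ⟨w, ?_⟩⟩
    change w • (w⁻¹ • q + x) ∈ alcove b
    rw [smul_add, smul_inv_smul, add_comm]
    exact mem_alcove_of_notMem_walls hP b h (notMem_walls_smul_add hP b hq w hx)
  aedisjoint := by
    intro g h hgh
    refine Disjoint.aedisjoint (Set.disjoint_left.2 fun x hx hx' => hgh ?_)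
    rw [Set.mem_vadd_set_iff_neg_vadd_mem] at hx hx'
    obtain ⟨w, hw⟩ := Set.mem_iUnion.1 hx
    obtain ⟨w', hw'⟩ := Set.mem_iUnion.1 hx'
    change w • (-(g : EuclideanSpace ℝ (Fin n)) + x) ∈ alcove b at hw
    change w' • (-(h : EuclideanSpace ℝ (Fin n)) + x) ∈ alcove b at hw'
    have hmem : w' • ((g : EuclideanSpace ℝ (Fin n)) - h) ∈ dualRootLattice b :=
      smul_mem_dualRootLattice hP b _ (sub_mem g.2 h.2)
    have heq : (w' * w⁻¹) • w • (-(g : EuclideanSpace ℝ (Fin n)) + x) +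
        w' • ((g : EuclideanSpace ℝ (Fin n)) - h) =
        w' • (-(h : EuclideanSpace ℝ (Fin n)) + x) := by
      rw [mul_smul, inv_smul_smul, ← smul_add]
      congr 1
      abel
    have h0 := (eq_one_of_alcove hP b hmem hw (heq ▸ hw')).2
    rw [smul_eq_zero_iff_eq, sub_eq_zero] at h0
    exact Subtype.ext h0

open scoped Pointwise in
-- A periodic function has equal integrals over a fundamental domain and its translate by `v`; the
-- translation also multiplies the integral by `planeWave ν v`, which can be chosen different from
-- `1`.
lemma setIntegral_planeWave_alcoveStar (hP : IsEuclidean P) (b : P.Base)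
    {ν : EuclideanSpace ℝ (Fin n)} (hν : ν ≠ 0)
    (hper : ∀ q ∈ dualRootLattice b, planeWave ν q = 1) :
    ∫ x in alcoveStar b, planeWave ν x = 0 := by
  obtain ⟨v, hv⟩ := exists_planeWave_ne_one hν
  have hD := isAddFundamentalDomain_alcoveStar hP b
  have h1 := hD.setIntegral_eq (hD.vadd_of_comm v) (f := planeWave ν) fun q x => by
    change planeWave ν (q + x) = _
    rw [planeWave_add, hper _ q.2, one_mul]
  have h2 : ∫ x in v +ᵥ alcoveStar b, planeWave ν x =
      ∫ x in alcoveStar b, planeWave ν (v + x) :=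
    (measurePreserving_add_left volume v).setIntegral_image_emb
      (measurableEmbedding_addLeft v) _ _
  simp only [planeWave_add, integral_const_mul] at h2
  rw [h2] at h1
  have h3 : (planeWave ν v - 1) * ∫ x in alcoveStar b, planeWave ν x = 0 := by
    rw [sub_mul, one_mul, ← h1, sub_self]
  exact (mul_eq_zero.1 h3).resolve_left (sub_ne_zero.2 hv)

/-- The integral over the star of alcoves vanishes term by term. By invariance it is also the order
of the Weyl group times the integral over one alcove, which agrees with `F` up to a null set. -/
lemma setIntegral_orbitFunction_eq_zero (hP : IsEuclidean P) (b : P.Base)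
    {lam : EuclideanSpace ℝ (Fin n)} (hlam : lam ∈ positiveWeights b) (h0 : lam ≠ 0) :
    ∫ x in fundamentalDomain b, orbitFunction (P := P) lam x = 0 := by
  have := Fintype.ofFinite P.weylGroup
  have hintA : ∀ f : EuclideanSpace ℝ (Fin n) → ℂ, Continuous f → ∀ w : P.weylGroup,
      IntegrableOn f ((fun x => w • x) ⁻¹' alcove b) volume := by
    intro f hf w
    have hK : IsCompact ((fun x : EuclideanSpace ℝ (Fin n) => w • x) ⁻¹' fundamentalDomain b) :=
      (weylIsometry hP w).toHomeomorph.isCompact_preimage.2 (isCompact_fundamentalDomain hP b)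
    exact (hf.continuousOn.integrableOn_compact hK).mono_set
      (Set.preimage_mono (alcove_subset_fundamentalDomain hP b))
  have hstar : ∫ x in alcoveStar b, orbitFunction (P := P) lam x = 0 := by
    simp only [orbitFunction_eq]
    rw [integral_finsetSum]
    · refine Finset.sum_eq_zero fun ν hν => ?_
      rw [Set.Finite.mem_toFinset] at hν
      exact setIntegral_planeWave_alcoveStar hP b (ne_zero_of_mem_orbit h0 hν) fun q hq =>
        planeWave_eq_one_of_mem_orbit hP b hlam hν hq
    · intro ν _
      exact integrableOn_finite_iUnion.2 (hintA _ (continuous_planeWave ν))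
  have hdisj : Pairwise (Function.onFun Disjoint
      fun w : P.weylGroup => (fun x => w • x) ⁻¹' alcove b) := by
    intro w w' hww
    refine Set.disjoint_left.2 fun x hx hx' => hww ?_
    have heq : (w' * w⁻¹) • w • x + 0 = w' • x := by
      rw [mul_smul, inv_smul_smul, add_zero]
    change w' • x ∈ alcove b at hx'
    have := (eq_one_of_alcove hP b (zero_mem _) hx (heq ▸ hx')).1
    exact (mul_inv_eq_one.1 this).symm
  rw [alcoveStar, integral_iUnion_fintype (fun w => measurableSet_weyl_preimage hP b w) hdisj
    (hintA _ (continuous_orbitFunction lam))] at hstar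
  have hterm : ∀ w : P.weylGroup, ∫ x in (fun x => w • x) ⁻¹' alcove b,
      orbitFunction (P := P) lam x = ∫ x in alcove b, orbitFunction (P := P) lam x := by
    intro w
    rw [← (measurePreserving_weyl hP w).setIntegral_preimage_emb (measurableEmbedding_weyl hP w)
      (orbitFunction (P := P) lam) (alcove b)]
    simp only [orbitFunction_smul hP]
  simp only [hterm, Finset.sum_const, Finset.card_univ, nsmul_eq_mul] at hstar
  rw [setIntegral_congr_set (fundamentalDomain_ae_eq_alcove hP b)]
  exact (mul_eq_zero.1 hstar).resolve_left (Nat.cast_ne_zero.2 Fintype.card_ne_zero)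

end Hyperplanes

/-! ### The index of the dual root lattice in the grid lattice -/

section GridLattice

variable {n : ℕ} {ι : Type*}
  {P : RootPairing ι ℝ (EuclideanSpace ℝ (Fin n)) (EuclideanSpace ℝ (Fin n))}

/-- The lattice `(1/M) P^∨`. -/
def gridLattice (b : P.Base) (M : ℕ) : AddSubgroup (EuclideanSpace ℝ (Fin n)) :=
  (dualWeightLattice b).comap (DistribSMul.toAddMonoidHom _ (M : ℝ))

lemma mem_gridLattice {b : P.Base} {M : ℕ} {x : EuclideanSpace ℝ (Fin n)} :
    x ∈ gridLattice b M ↔ (M : ℝ) • x ∈ dualWeightLattice b := Iff.rfl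

lemma mem_dualWeightLattice {b : P.Base} {x : EuclideanSpace ℝ (Fin n)} :
    x ∈ dualWeightLattice b ↔ ∀ i ∈ b.support, ∃ k : ℤ, ⟪x, P.root i⟫ = k := Iff.rfl

lemma dualRootLattice_le_gridLattice [P.IsCrystallographic] (hP : IsEuclidean P) (b : P.Base)
    (M : ℕ) : dualRootLattice b ≤ gridLattice b M := by
  intro q hq i _
  obtain ⟨m, hm⟩ := exists_int_inner_root hP b hq i
  refine ⟨M * m, ?_⟩
  change ⟪(M : ℝ) • q, P.root i⟫ = _
  rw [inner_smul_left, hm]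
  simp

lemma smul_mem_gridLattice [Finite ι] [P.IsRootSystem] (hP : IsEuclidean P) (b : P.Base) {M : ℕ}
    {x : EuclideanSpace ℝ (Fin n)} (hx : x ∈ gridLattice b M) (w : P.weylGroup) :
    w • x ∈ gridLattice b M := by
  rw [mem_gridLattice, mem_dualWeightLattice] at hx ⊢
  intro i _
  rw [← smul_comm w, hP.inner_smul_left_eq, RootPairing.weylGroup_apply_root,
    inner_root_eq_sum b]
  obtain ⟨f, hf, -⟩ := exists_int_coeff b (P.weylGroupToPerm w⁻¹ i)
  choose g hg using fun j : b.support => hx j j.2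
  refine ⟨∑ j, f j * g j, ?_⟩
  simp only [hf, hg, Int.cast_sum, Int.cast_mul]

variable [P.IsRootSystem]

/-- The basis of `ℝⁿ` consisting of the vectors `(1/M) ω_i^∨`. -/
def gridBasis (hP : IsEuclidean P) (b : P.Base) {M : ℕ} (hM : 0 < M) :
    Basis b.support ℝ (EuclideanSpace ℝ (Fin n)) :=
  Basis.ofEquivFun
    { toFun := fun x i => M * ⟪x, P.root i⟫
      map_add' := fun x y => by ext i; simp [inner_add_left, mul_add]
      map_smul' := fun a x => by ext i; simp [inner_smul_left]; ring
      invFun := fun y => ∑ i, (y i / M) • omegaCheck b i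
      left_inv := fun x => by
        have hM' : (M : ℝ) ≠ 0 := by positivity
        conv_rhs => rw [eq_sum_omegaCheck hP b x]
        refine Finset.sum_congr rfl fun i _ => ?_
        rw [mul_div_cancel_left₀ _ hM']
      right_inv := fun y => by
        have hM' : (M : ℝ) ≠ 0 := by positivity
        ext i
        change M * ⟪∑ i, (y i / M) • omegaCheck b i, P.root i⟫ = y i
        rw [inner_sum_omegaCheck hP b fun i => y i / M, mul_div_cancel₀ _ hM'] }

lemma gridBasis_repr (hP : IsEuclidean P) (b : P.Base) {M : ℕ} (hM : 0 < M)
    (x : EuclideanSpace ℝ (Fin n)) (i : b.support) :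
    (gridBasis hP b hM).repr x i = M * ⟪x, P.root i⟫ := rfl

lemma gridLattice_eq_closure (hP : IsEuclidean P) (b : P.Base) {M : ℕ} (hM : 0 < M) :
    gridLattice b M = AddSubgroup.closure (Set.range (gridBasis hP b hM)) := by
  ext x
  rw [← Submodule.span_int_eq_addSubgroupClosure, Submodule.mem_toAddSubgroup,
    Basis.mem_span_iff_repr_mem, mem_gridLattice, mem_dualWeightLattice]
  simp [gridBasis_repr, inner_smul_left, eq_comm]

lemma dualRootLattice_eq_closure (b : P.Base) :
    dualRootLattice b = AddSubgroup.closure (Set.range b.toCoweightBasis) := by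
  rw [dualRootLattice]
  congr 1
  ext x
  simp

lemma card_support (b : P.Base) : Fintype.card b.support = n := by
  rw [← Module.finrank_eq_card_basis b.toWeightBasis]
  simp

omit [P.IsRootSystem] in
-- The Cartan matrix is the Gram matrix of the simple roots, which is positive definite, times a
-- positive diagonal matrix.
lemma cartanDet_pos [P.IsCrystallographic] (hP : IsEuclidean P) (b : P.Base) :
    0 < cartanDet b := by
  classical
  have hG : (Matrix.gram ℝ fun i : b.support => P.root i).PosDef :=
    Matrix.posDef_gram_of_linearIndependent b.linearIndepOn_root
  have hmat : b.cartanMatrix.map (Int.cast : ℤ → ℝ) =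
      (Matrix.gram ℝ fun i : b.support => P.root i) *
        Matrix.diagonal fun i : b.support => 2 / ⟪P.root i, P.root i⟫ := by
    ext i j
    rw [Matrix.mul_diagonal, Matrix.gram_apply, Matrix.map_apply]
    have h1 : ((b.cartanMatrix i j : ℤ) : ℝ) = P.pairing i j := by
      rw [← P.algebraMap_pairingIn ℤ]; rfl
    rw [h1, ← hP.inner_root_coroot, hP.coroot_eq, inner_smul_right, mul_comm]
  have hdet : (cartanDet b : ℝ) = (b.cartanMatrix.map (Int.cast : ℤ → ℝ)).det := by
    rw [cartanDet]
    convert! Int.cast_det b.cartanMatrix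
  have : (0 : ℝ) < cartanDet b := by
    rw [hdet, hmat, Matrix.det_mul, Matrix.det_diagonal]
    refine mul_pos hG.det_pos (Finset.prod_pos fun i _ => ?_)
    have : 0 < ⟪P.root i, P.root i⟫ := real_inner_self_pos.2 (P.ne_zero i)
    positivity
  exact_mod_cast this

lemma relIndex_gridLattice [P.IsCrystallographic] (hP : IsEuclidean P) (b : P.Base) {M : ℕ}
    (hM : 0 < M) :
    ((dualRootLattice b).relIndex (gridLattice b M) : ℤ) = cartanDet b * (M : ℤ) ^ n := by
  classical
  have hle := dualRootLattice_le_gridLattice hP b M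
  set b₁ := b.toCoweightBasis.addSubgroupOfClosure (dualRootLattice b)
    (dualRootLattice_eq_closure b) with hb₁
  set b₂ := (gridBasis hP b hM).addSubgroupOfClosure (gridLattice b M)
    (gridLattice_eq_closure hP b hM) with hb₂
  -- The coordinate of `α_j^∨` along `ω_i^∨/M` is `M⟨α_j^∨, α_i⟩`.
  have hmat : b₂.toMatrix (fun i => ⟨b₁ i, hle (SetLike.coe_mem _)⟩) =
      (M : ℤ) • b.cartanMatrix := by
    ext i j
    have h1 : ((b.cartanMatrix i j : ℤ) : ℝ) = P.pairing i j := by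
      rw [← P.algebraMap_pairingIn ℤ]; rfl
    have h2 : (b₁ j : EuclideanSpace ℝ (Fin n)) = P.coroot j := by simp [hb₁]
    have this : ((b₂.repr ⟨b₁ j, hle (SetLike.coe_mem _)⟩ i : ℤ) : ℝ) =
        (((M : ℤ) * b.cartanMatrix i j : ℤ) : ℝ) := by
      refine (Basis.addSubgroupOfClosure_repr_apply _ _ _ _ _).trans ?_
      rw [gridBasis_repr, Int.cast_mul, h1, ← hP.inner_root_coroot, real_inner_comm, ← h2]
      rfl
    exact_mod_cast this
  rw [AddSubgroup.relIndex_eq_natAbs_det _ _ hle b₁ b₂, Basis.det_apply, hmat,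
    Matrix.det_smul, card_support]
  have hc : b.cartanMatrix.det = cartanDet b := by
    rw [cartanDet]
  rw [hc, mul_comm, Int.natAbs_of_nonneg]
  exact mul_nonneg (cartanDet_pos hP b).le (by positivity)

end GridLattice

/-! ### Character sums over the finite subgroup of the torus -/

section TorusPoints

variable {n : ℕ} {ι : Type*}
  {P : RootPairing ι ℝ (EuclideanSpace ℝ (Fin n)) (EuclideanSpace ℝ (Fin n))}

/-- The finite subgroup `(1/M) P^∨ / Q^∨` of the torus `ℝⁿ / Q^∨`. -/
def torusPoints (b : P.Base) (M : ℕ) :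
    AddSubgroup (EuclideanSpace ℝ (Fin n) ⧸ dualRootLattice b) :=
  (gridLattice b M).map (QuotientAddGroup.mk' (dualRootLattice b))

variable [P.IsRootSystem] [P.IsCrystallographic]

lemma card_torusPoints (hP : IsEuclidean P) (b : P.Base) {M : ℕ} (hM : 0 < M) :
    (Nat.card (torusPoints b M) : ℤ) = cartanDet b * (M : ℤ) ^ n := by
  rw [← relIndex_gridLattice hP b hM, torusPoints, ← AddSubgroup.relIndex_ker,
    QuotientAddGroup.ker_mk']

lemma finite_torusPoints (hP : IsEuclidean P) (b : P.Base) {M : ℕ} (hM : 0 < M) :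
    Finite (torusPoints b M) := by
  refine Nat.finite_of_card_ne_zero fun h => ?_
  have h1 := card_torusPoints hP b hM
  rw [h, Nat.cast_zero] at h1
  exact (mul_pos (cartanDet_pos hP b) (by positivity : 0 < (M : ℤ) ^ n)).ne h1

omit [P.IsRootSystem] in
lemma mk_mem_torusPoints (hP : IsEuclidean P) (b : P.Base) {M : ℕ}
    {x : EuclideanSpace ℝ (Fin n)} :
    (QuotientAddGroup.mk x : EuclideanSpace ℝ (Fin n) ⧸ dualRootLattice b) ∈ torusPoints b M ↔
      x ∈ gridLattice b M := by
  constructor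
  · rintro ⟨y, hy, h⟩
    have hyx : -y + x ∈ dualRootLattice b := QuotientAddGroup.eq.1 h
    have := add_mem hy (dualRootLattice_le_gridLattice hP b M hyx)
    rwa [add_neg_cancel_left] at this
  · intro hx
    exact ⟨x, hx, rfl⟩

omit [P.IsRootSystem] in
/-- A plane wave that is nontrivial on the grid lattice sums to zero over the torus points. -/
lemma sum_planeWave_torusPoints (hP : IsEuclidean P) (b : P.Base) {M : ℕ}
    [Fintype (torusPoints b M)] {ν y : EuclideanSpace ℝ (Fin n)}
    (hper : ∀ q ∈ dualRootLattice b, planeWave ν q = 1)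
    (hy : y ∈ gridLattice b M) (hne : planeWave ν y ≠ 1) :
    ∑ t : torusPoints b M,
      planeWave ν (Quotient.out (t : EuclideanSpace ℝ (Fin n) ⧸ dualRootLattice b)) = 0 := by
  have hout : ∀ {t : EuclideanSpace ℝ (Fin n) ⧸ dualRootLattice b} {x : EuclideanSpace ℝ (Fin n)},
      QuotientAddGroup.mk x = t → planeWave ν t.out = planeWave ν x := by
    intro t x h
    have h1 : (QuotientAddGroup.mk x : EuclideanSpace ℝ (Fin n) ⧸ dualRootLattice b) =
        QuotientAddGroup.mk t.out := h.trans (QuotientAddGroup.out_eq' t).symm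
    have h2 := hper _ (QuotientAddGroup.eq.1 h1)
    rw [← add_neg_cancel_left x t.out, planeWave_add, h2, mul_one]
  -- Shifting the summation by the class of `y` multiplies the sum by `planeWave ν y ≠ 1`, so the
  -- sum is zero.
  set s : torusPoints b M := ⟨QuotientAddGroup.mk y, (mk_mem_torusPoints hP b).2 hy⟩ with hs
  have hshift := Equiv.sum_comp (Equiv.addLeft s) fun t : torusPoints b M =>
    planeWave ν (Quotient.out (t : EuclideanSpace ℝ (Fin n) ⧸ dualRootLattice b))
  have hterm : ∀ t : torusPoints b M,
      planeWave ν (Quotient.out ((Equiv.addLeft s t : torusPoints b M) :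
        EuclideanSpace ℝ (Fin n) ⧸ dualRootLattice b)) =
      planeWave ν y * planeWave ν (Quotient.out (t : EuclideanSpace ℝ (Fin n) ⧸ dualRootLattice b)) := by
    intro t
    rw [← planeWave_add]
    refine hout ?_
    rw [QuotientAddGroup.mk_add, QuotientAddGroup.out_eq']
    rfl
  simp only [hterm, ← Finset.mul_sum] at hshift
  have h3 : (planeWave ν y - 1) * ∑ t : torusPoints b M,
      planeWave ν (Quotient.out (t : EuclideanSpace ℝ (Fin n) ⧸ dualRootLattice b)) = 0 := by
    rw [sub_mul, one_mul, hshift, sub_self]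
  exact (mul_eq_zero.1 h3).resolve_left (sub_ne_zero.2 hne)

end TorusPoints

/-! ### The degree bound -/

section Degree

variable {n : ℕ} {ι : Type*} [Finite ι] [Nonempty ι]
  {P : RootPairing ι ℝ (EuclideanSpace ℝ (Fin n)) (EuclideanSpace ℝ (Fin n))}
  [P.IsRootSystem] [P.IsCrystallographic] [P.IsReduced] [P.IsIrreducible]

lemma inner_root_le_highest (b : P.Base) {x : EuclideanSpace ℝ (Fin n)}
    (hx : ∀ i : b.support, 0 ≤ ⟪x, P.root i⟫) (k : ι) :
    ⟪x, P.root k⟫ ≤ ⟪x, P.root (highestIdx b)⟫ := by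
  rw [inner_root_eq_sum b, inner_root_eq_sum b x (highestIdx b)]
  exact Finset.sum_le_sum fun j _ =>
    mul_le_mul_of_nonneg_right (repr_le_repr_highestIdx b k j) (hx j)

lemma inner_coroot_le_mDegree (hP : IsEuclidean P) (b : P.Base)
    {lam : EuclideanSpace ℝ (Fin n)} (hlam : lam ∈ positiveWeights b) (k : ι) :
    ⟪lam, P.coroot k⟫ ≤ mDegree b lam := by
  -- In the dual system the coroots are the roots, and `η` is the highest one.
  refine inner_root_le_highest (P := P.flip) b.flip (fun i => ?_) k
  obtain ⟨m, hm⟩ := exists_nat_inner_coroot hP b hlam i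
  change 0 ≤ ⟪lam, P.coroot i⟫
  rw [hm]
  positivity

omit [Finite ι] [Nonempty ι] [P.IsCrystallographic] [P.IsReduced] [P.IsIrreducible] in
lemma eq_sum_inner_omegaCheck_smul (hP : IsEuclidean P) (b : P.Base)
    (x : EuclideanSpace ℝ (Fin n)) :
    x = ∑ i : b.support, ⟪x, omegaCheck b i⟫ • P.root i := by
  refine ext_inner_right ℝ fun y => ?_
  conv_lhs => rw [eq_sum_omegaCheck hP b y]
  simp only [inner_sum, sum_inner, inner_smul_left, inner_smul_right, conj_trivial]
  refine Finset.sum_congr rfl fun i _ => ?_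
  rw [mul_comm, real_inner_comm y]

/-- A nonzero positive weight of degree less than `2M` is not in the dual of the grid lattice. -/
lemma exists_mem_gridLattice_planeWave_ne_one (hP : IsEuclidean P) (b : P.Base) {M : ℕ}
    (hM : 0 < M) {lam : EuclideanSpace ℝ (Fin n)} (hlam : lam ∈ positiveWeights b)
    (hdeg : mDegree b lam < 2 * M) (h0 : lam ≠ 0) :
    ∃ y ∈ gridLattice b M, planeWave lam y ≠ 1 := by
  classical
  by_contra! hall
  have hM' : (0 : ℝ) < M := by exact_mod_cast hM
  -- Testing triviality on `ω_i^∨/M` shows that the coefficient of `α_i` in `λ` is a multiple of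
  -- `M`.
  have hint : ∀ i : b.support, ∃ m : ℤ, ⟪lam, omegaCheck b i⟫ = M * m := by
    intro i
    have hmem : (1 / M : ℝ) • omegaCheck b i ∈ gridLattice b M := by
      rw [mem_gridLattice, mem_dualWeightLattice, smul_smul, mul_one_div_cancel hM'.ne', one_smul]
      intro j hj
      have := inner_root_omegaCheck hP b i ⟨j, hj⟩
      exact ⟨if i = ⟨j, hj⟩ then 1 else 0, by rw [this]; push_cast; rfl⟩
    obtain ⟨m, hm⟩ := (planeWave_eq_one_iff _ _).1 (hall _ hmem)
    refine ⟨m, ?_⟩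
    rw [inner_smul_right] at hm
    rw [← hm]
    field_simp
  choose m hm using hint
  set μ : EuclideanSpace ℝ (Fin n) := ∑ i, m i • P.root i with hμ
  have hlamμ : lam = (M : ℝ) • μ := by
    rw [eq_sum_inner_omegaCheck_smul hP b lam, hμ, Finset.smul_sum]
    refine Finset.sum_congr rfl fun i _ => ?_
    rw [hm, mul_smul, Int.cast_smul_eq_zsmul]
  have hμ0 : μ ≠ 0 := by
    rintro h
    rw [h, smul_zero] at hlamμ
    exact h0 hlamμ
  have hμmem : μ ∈ AddSubgroup.closure (Set.range P.root) :=
    sum_mem fun i _ => zsmul_mem (AddSubgroup.subset_closure (Set.mem_range_self i.1)) _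
  -- This coroot pairs with `λ = Mμ` to at least `2M`, against the bound on the degree.
  obtain ⟨k, hk⟩ := exists_two_le_pairing hμmem hμ0
  rw [hP.toLinearMap_apply] at hk
  have h1 := inner_coroot_le_mDegree hP b hlam k
  rw [hlamμ, inner_smul_left, ← hlamμ, conj_trivial] at h1
  nlinarith

end Degree

/-! ### From the weighted grid sum to the torus -/

section GridSum

variable {n : ℕ} {ι : Type*} [Finite ι] [Nonempty ι]
  {P : RootPairing ι ℝ (EuclideanSpace ℝ (Fin n)) (EuclideanSpace ℝ (Fin n))}
  [P.IsRootSystem] [P.IsCrystallographic] [P.IsReduced] [P.IsIrreducible]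

omit [Finite ι] [Nonempty ι] [P.IsRootSystem] [P.IsCrystallographic] [P.IsReduced]
  [P.IsIrreducible] in
lemma exists_of_mk_smul_eq (b : P.Base) {w w' : P.weylGroup} (hP : IsEuclidean P)
    {x y : EuclideanSpace ℝ (Fin n)}
    (h : (QuotientAddGroup.mk (w • x) : EuclideanSpace ℝ (Fin n) ⧸ dualRootLattice b) =
      QuotientAddGroup.mk (w' • y)) :
    ∃ u : P.weylGroup, ∃ q ∈ dualRootLattice b, u • x + q = y := by
  refine ⟨w'⁻¹ * w, w'⁻¹ • (-(w • x) + w' • y),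
    smul_mem_dualRootLattice hP b _ (QuotientAddGroup.eq.1 h), ?_⟩
  rw [mul_smul, ← smul_add, add_neg_cancel_left, inv_smul_smul]

lemma eq_of_mk_smul_eq (hP : IsEuclidean P) (b : P.Base) {M : ℕ} {w w' : P.weylGroup}
    {x y : EuclideanSpace ℝ (Fin n)} (hx : x ∈ grid b M) (hy : y ∈ grid b M)
    (h : (QuotientAddGroup.mk (w • x) : EuclideanSpace ℝ (Fin n) ⧸ dualRootLattice b) =
      QuotientAddGroup.mk (w' • y)) : x = y := by
  obtain ⟨u, q, hq, hu⟩ := exists_of_mk_smul_eq b hP h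
  exact eq_of_mem_fundamentalDomain hP b hq hx.1 hy.1 hu

/-- Distinct points of `F` are not congruent modulo `Q^∨`, so the grid embeds in the finite group of
torus points. -/
lemma finite_grid (hP : IsEuclidean P) (b : P.Base) {M : ℕ} (hM : 0 < M) :
    (grid b M).Finite := by
  have := finite_torusPoints hP b hM
  refine Set.Finite.of_finite_image
    (f := fun x => (QuotientAddGroup.mk x : EuclideanSpace ℝ (Fin n) ⧸ dualRootLattice b))
    ((Set.toFinite (torusPoints b M : Set _)).subset ?_) ?_
  · rintro _ ⟨x, hx, rfl⟩
    exact (mk_mem_torusPoints hP b).2 hx.2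
  · intro x hx y hy h
    refine eq_of_mk_smul_eq hP b (w := 1) (w' := 1) hx hy ?_
    simpa only [one_smul] using h

/-- Weighted sums of invariant functions over the grid are sums over the torus points. -/
lemma sum_grid_eq_sum_torusPoints (hP : IsEuclidean P) (b : P.Base) {M : ℕ} (hM : 0 < M)
    [Fintype (torusPoints b M)] (f : EuclideanSpace ℝ (Fin n) → ℂ)
    (hw : ∀ (w : P.weylGroup) (x), f (w • x) = f x)
    (hq : ∀ q ∈ dualRootLattice b, ∀ x, f (x + q) = f x) :
    ∑ᶠ x ∈ grid b M, (orbitCard b x : ℂ) * f x =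
      ∑ t : torusPoints b M,
        f (Quotient.out (t : EuclideanSpace ℝ (Fin n) ⧸ dualRootLattice b)) := by
  classical
  have hout : ∀ {t : EuclideanSpace ℝ (Fin n) ⧸ dualRootLattice b} {x : EuclideanSpace ℝ (Fin n)},
      QuotientAddGroup.mk x = t → f t.out = f x := by
    intro t x h
    have h1 : (QuotientAddGroup.mk x : EuclideanSpace ℝ (Fin n) ⧸ dualRootLattice b) =
        QuotientAddGroup.mk t.out := h.trans (QuotientAddGroup.out_eq' t).symm
    have h2 := hq _ (QuotientAddGroup.eq.1 h1) x
    rwa [add_neg_cancel_left] at h2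
  have horb : ∀ x, (Set.range fun w : P.weylGroup =>
      (QuotientAddGroup.mk (w • x) : EuclideanSpace ℝ (Fin n) ⧸ dualRootLattice b)).Finite :=
    fun x => Set.finite_range _
  -- Finiteness of the grid makes the `finsum` a genuine sum and not the default `0`.
  rw [finsum_mem_eq_finite_toFinset_sum _ (finite_grid hP b hM)]
  -- The torus points are partitioned into Weyl orbits with one representative each in the grid, and
  -- `f` is constant on each orbit, whose size is `ε(x)`.
  have hcover : (Set.toFinite (torusPoints b M : Set _)).toFinset =
      (finite_grid hP b hM).toFinset.biUnion fun x => (horb x).toFinset := by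
    ext t
    simp only [Set.Finite.mem_toFinset, Finset.mem_biUnion, SetLike.mem_coe, Set.mem_range]
    constructor
    · intro ht
      obtain ⟨x, rfl⟩ := QuotientAddGroup.mk_surjective t
      rw [mk_mem_torusPoints hP b] at ht
      obtain ⟨w, q, hqm, hF⟩ := exists_smul_add_mem_fundamentalDomain hP b x
      refine ⟨w • x + q, ⟨hF, add_mem (smul_mem_gridLattice hP b ht w)
        (dualRootLattice_le_gridLattice hP b M hqm)⟩, w⁻¹, ?_⟩
      rw [smul_add, inv_smul_smul]
      exact QuotientAddGroup.mk_add_of_mem _ (smul_mem_dualRootLattice hP b _ hqm)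
    · rintro ⟨x, hx, w, rfl⟩
      exact (mk_mem_torusPoints hP b).2 (smul_mem_gridLattice hP b hx.2 w)
  have hT : ∑ t : torusPoints b M,
      f (Quotient.out (t : EuclideanSpace ℝ (Fin n) ⧸ dualRootLattice b)) =
      ∑ t ∈ (Set.toFinite (torusPoints b M : Set (EuclideanSpace ℝ (Fin n) ⧸ dualRootLattice b))).toFinset,
        f t.out := by
    refine (Finset.sum_subtype _ (fun t => ?_)
      fun t : EuclideanSpace ℝ (Fin n) ⧸ dualRootLattice b => f t.out).symm
    rw [Set.Finite.mem_toFinset]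
    rfl
  rw [hT, hcover, Finset.sum_biUnion]
  · refine Finset.sum_congr rfl fun x _ => ?_
    have hconst : ∀ t ∈ (horb x).toFinset, f (Quotient.out t) = f x := by
      intro t ht
      rw [Set.Finite.mem_toFinset] at ht
      obtain ⟨w, rfl⟩ := ht
      exact (hout rfl).trans (hw w x)
    rw [Finset.sum_congr rfl hconst, Finset.sum_const, nsmul_eq_mul, orbitCard,
      Set.ncard_eq_toFinset_card _ (horb x)]
  · intro x hx y hy hxy
    refine Finset.disjoint_left.2 fun t ht ht' => hxy ?_
    rw [Set.Finite.mem_toFinset] at ht ht'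
    rw [Finset.mem_coe, Set.Finite.mem_toFinset] at hx hy
    obtain ⟨w, hw⟩ := ht
    obtain ⟨w', hw'⟩ := ht'
    exact eq_of_mk_smul_eq hP b hx hy (hw.trans hw'.symm)

/-- If `y` detects that `λ` is nontrivial on the grid lattice, then `w • y` does so for `w • λ`;
thus every term of the orbit sums to zero. -/
lemma sum_orbitFunction_torusPoints (hP : IsEuclidean P) (b : P.Base) {M : ℕ} (hM : 0 < M)
    [Fintype (torusPoints b M)] {lam : EuclideanSpace ℝ (Fin n)} (hlam : lam ∈ positiveWeights b)
    (hdeg : mDegree b lam < 2 * M) (h0 : lam ≠ 0) :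
    ∑ t : torusPoints b M, orbitFunction (P := P) lam
      (Quotient.out (t : EuclideanSpace ℝ (Fin n) ⧸ dualRootLattice b)) = 0 := by
  simp only [orbitFunction_eq]
  rw [Finset.sum_comm]
  refine Finset.sum_eq_zero fun ν hν => ?_
  rw [Set.Finite.mem_toFinset] at hν
  have hper := fun q hq => planeWave_eq_one_of_mem_orbit (q := q) hP b hlam hν hq
  obtain ⟨y, hy, hne⟩ := exists_mem_gridLattice_planeWave_ne_one hP b hM hlam hdeg h0
  obtain ⟨w, rfl⟩ := hν
  refine sum_planeWave_torusPoints hP b hper (smul_mem_gridLattice hP b hy w) ?_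
  rw [planeWave] at hne ⊢
  simp only [hP.inner_smul_smul]
  exact hne

end GridSum

end OrbitCubature

end

/-! ### The cubature formula -/

theorem mainTheorem7 {n : ℕ} {ι : Type*} [Finite ι] [Nonempty ι]
    (P : RootPairing ι ℝ (EuclideanSpace ℝ (Fin n)) (EuclideanSpace ℝ (Fin n)))
    [P.IsRootSystem] [P.IsCrystallographic] [P.IsReduced] [P.IsIrreducible]
    (hP : OrbitCubature.IsEuclidean P) (b : P.Base)
    (M : ℕ) (hM : 0 < M)
    (lam : EuclideanSpace ℝ (Fin n))
    (hlam : lam ∈ OrbitCubature.positiveWeightsLE b (2 * M - 1)) :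
    (OrbitCubature.grid b M).Finite ∧
    IntegrableOn (OrbitCubature.orbitFunction (P := P) lam)
      (OrbitCubature.fundamentalDomain b) volume ∧
    (1 / (volume.real (OrbitCubature.fundamentalDomain b) : ℂ)) *
        ∫ x in OrbitCubature.fundamentalDomain b, OrbitCubature.orbitFunction (P := P) lam x =
      (1 / ((OrbitCubature.cartanDet b : ℂ) * (M : ℂ) ^ n)) *
        ∑ᶠ x ∈ OrbitCubature.grid b M,
          (OrbitCubature.orbitCard b x : ℂ) * OrbitCubature.orbitFunction (P := P) lam x := by

  have := OrbitCubature.finite_torusPoints hP b hM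
  have := Fintype.ofFinite (OrbitCubature.torusPoints b M)
  refine ⟨OrbitCubature.finite_grid hP b hM,
    OrbitCubature.integrableOn_fundamentalDomain hP b lam, ?_⟩
  have hdeg : OrbitCubature.mDegree b lam < 2 * M := by
    refine hlam.2.trans_lt ?_
    -- The subtraction `2 * M - 1` is in `ℕ`; it is not truncated because `M ≥ 1`.
    rw [Nat.cast_sub (by omega)]
    push_cast
    linarith
  rw [OrbitCubature.sum_grid_eq_sum_torusPoints hP b hM _
    (fun w x => OrbitCubature.orbitFunction_smul hP lam x w)
    (fun q hq x => OrbitCubature.orbitFunction_add hP b hlam.1 hq x)]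
  -- For the constant function the formula says that the number of torus points is `c Mⁿ`; otherwise
  -- both sides are zero.
  by_cases h0 : lam = 0
  · subst h0
    have hcard : (Fintype.card (OrbitCubature.torusPoints b M) : ℂ) =
        (OrbitCubature.cartanDet b : ℂ) * (M : ℂ) ^ n := by
      have := OrbitCubature.card_torusPoints hP b hM
      rw [Nat.card_eq_fintype_card] at this
      exact_mod_cast this
    have hne : (OrbitCubature.cartanDet b : ℂ) * (M : ℂ) ^ n ≠ 0 :=
      mul_ne_zero (Int.cast_ne_zero.2 (OrbitCubature.cartanDet_pos hP b).ne')
        (pow_ne_zero _ (Nat.cast_ne_zero.2 hM.ne'))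
    have hvol : (volume.real (OrbitCubature.fundamentalDomain b) : ℂ) ≠ 0 :=
      Complex.ofReal_ne_zero.2 (OrbitCubature.volume_real_fundamentalDomain_ne_zero hP b)
    simp only [OrbitCubature.orbitFunction_zero, Finset.sum_const, Finset.card_univ, hcard,
      nsmul_eq_mul, mul_one, setIntegral_const, one_div, Complex.real_smul]
    rw [inv_mul_cancel₀ hne, inv_mul_cancel₀ hvol]
  · rw [OrbitCubature.setIntegral_orbitFunction_eq_zero hP b hlam.1 h0,
      OrbitCubature.sum_orbitFunction_torusPoints hP b hM hlam.1 hdeg h0, mul_zero, mul_zero]
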